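/- Let $K\subset\mathbb{R}^3$ be a knot, i.e. the image of a $C^2$ embedding (injective immersion) of the circle, given by a $1$-periodic parametrization $s\mapsto K(s)$, and let $\Delta$ be the diagonal of $K\times K$. Let $dx,dy$ denote arc-length elements and let $d_K(x,y)$ be the length of the shorter arc of $K$ between $x$ and $y$. The Möbius energy of $K$ is $$E_\circ^{(2)}(K)=-4+\iint_{K\times K}\left(\frac1{|x-y|^2}-\frac1{d_K(x,y)^2}\right)dx\,dy .$$ For $x=K(s)\neq y=K(t)$ let $\Sigma\subset\mathbb{R}^3\cup\{\infty\}$ be a $2$-sphere (round sphere or plane) tangent to $K$ at both $x$ and $y$, and let $p$ be a stereographic projection of $\Sigma$ to $\mathbb{C}\cup\{\infty\}$ from a point of $\Sigma\cap\mathbb{R}^3$ other than $x$ and $y$. Put $\tilde x=p(x)$, $\tilde y=p(y)$, $\widetilde{dx}=dp_x(K'(s))\,ds$, $\widetilde{dy}=dp_y(K'(t))\,dt$. The infinitesimal cross ratio $\Omega_K(x,y)$ is the leading term of the cross ratio $$(\tilde x+\widetilde{dx},\tilde y;\tilde x,\tilde y+\widetilde{dy})=\frac{(\tilde x+\widetilde{dx})-\tilde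 x}{(\tilde x+\widetilde{dx})-(\tilde y+\widetilde{dy})}:\frac{\tilde y-\tilde x}{\tilde y-(\tilde y+\widetilde{dy})}\sim\frac{\widetilde{dx}\,\widetilde{dy}}{(\tilde x-\tilde y)^2},$$ written $\Omega_K=\omega(s,t)\,ds\,dt$ with $\omega(s,t)\in\mathbb{C}$, where the orientation of $\Sigma$ is chosen so that $\operatorname{Im}\omega\ge 0$. Then $\Omega_K(x,y)$ exists and is independent of the choice of $\Sigma$ and $p$ for all $(x,y)\in K\times K\setminus\Delta$; the integrands of $E_\circ^{(2)}(K)$ and of $\iint_{K\times K\setminus\Delta}(|\Omega_K|-\operatorname{Re}\Omega_K)$ are absolutely integrable; and $$E_\circ^{(2)}(K)=\iint_{K\times K\setminus\Delta}\bigl(|\Omega_K|-\operatorname{Re}\Omega_K\bigr),$$ where $|\Omega_K|=|\omega|\,ds\,dt$ and $\operatorname{Re}\Omega_K=(\operatorname{Re}\omega)\,ds\,dt$. -/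

import Mathlib

open scoped Topology

noncomputable section

/-- Euclidean three-space. -/
abbrev E3 : Type := EuclideanSpace ℝ (Fin 3)

/-- A knot: a `C²` embedding of the circle `ℝ/ℤ` in `ℝ³`, written as a `1`-periodic immersion of
the line which is injective on a period. -/
structure Knot where
  toFun : ℝ → E3
  contDiff : ContDiff ℝ 2 toFun
  periodic : Function.Periodic toFun 1
  immersion : ∀ s, deriv toFun s ≠ 0
  injOn : Set.InjOn toFun (Set.Ico 0 1)

namespace Knot

variable (K : Knot)

/-- The velocity vector at the parameter `s`. -/
def velocity (s : ℝ) : E3 := deriv K.toFun s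

/-- The (signed) length of the arc from the parameter `a` to the parameter `b`. -/
def arcLength (a b : ℝ) : ℝ := ∫ u in a..b, ‖K.velocity u‖

/-- The total length of the knot. -/
def length : ℝ := K.arcLength 0 1

/-- The length of the shorter of the two arcs of the knot between the points with parameters
`s, t ∈ [0, 1)`. -/
def arcDist (s t : ℝ) : ℝ := min |K.arcLength s t| (K.length - |K.arcLength s t|)

/-- The square `[0, 1)²`, in bijection with `K × K`. -/
def square : Set (ℝ × ℝ) := Set.Ico 0 1 ×ˢ Set.Ico 0 1

/-- The square without its diagonal, in bijection with `K × K` without its diagonal. -/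
def offDiagSquare : Set (ℝ × ℝ) := {p ∈ square | p.1 ≠ p.2}

/-- The coefficient with respect to `ds dt` of `(1 / |x - y|² - 1 / d_K(x, y)²) dx dy`, where
`x = K(s)`, `y = K(t)` and `dx`, `dy` are the arc-length elements. -/
def energyIntegrand (p : ℝ × ℝ) : ℝ :=
  (1 / ‖K.toFun p.1 - K.toFun p.2‖ ^ 2 - 1 / K.arcDist p.1 p.2 ^ 2) *
    (‖K.velocity p.1‖ * ‖K.velocity p.2‖)

/-- The Möbius energy `-4 + ∬_{K × K} (1 / |x - y|² - 1 / d_K(x, y)²) dx dy`. -/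
def energy : ℝ := -4 + ∫ p in square, K.energyIntegrand p

end Knot

/-- A `2`-sphere in `ℝ³ ∪ {∞}`, with the equation `a |v|² + 2 ⟨b, v⟩ + c = 0`, where
`|b|² - a c > 0`. If `a ≠ 0` it is the round sphere with centre `-b / a` and radius
`√(|b|² - a c) / |a|`; if `a = 0` it is the plane `2 ⟨b, v⟩ + c = 0` (with the point at infinity)
and `b ≠ 0`. -/
structure TwoSphere where
  a : ℝ
  b : E3
  c : ℝ
  nondegenerate : 0 < ‖b‖ ^ 2 - a * c

namespace TwoSphere

/-- The finite points of the sphere. -/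
def carrier (S : TwoSphere) : Set E3 :=
  {v | S.a * ‖v‖ ^ 2 + 2 * inner ℝ S.b v + S.c = 0}

/-- The tangent plane, as a linear subspace, at a finite point `v` of the sphere: the vectors
orthogonal to the (nonzero) half gradient `a v + b` of the equation. -/
def tangentSpace (S : TwoSphere) (v : E3) : Submodule ℝ E3 := (ℝ ∙ (S.a • v + S.b))ᗮ

/-- The sphere is tangent to the knot at the point with parameter `s`. -/
def IsTangentAt (S : TwoSphere) (K : Knot) (s : ℝ) : Prop :=
  K.toFun s ∈ S.carrier ∧ K.velocity s ∈ S.tangentSpace (K.toFun s)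

end TwoSphere

/-- A stereographic projection of the sphere `S` from a point `N` of `S` to `ℂ`. The inversion with
centre `N` takes `S ∖ {N}` to a plane parallel to the tangent plane of `S` at `N`, and
`e₁, e₂` are orthonormal coordinate vectors of that plane. Both orientations are allowed. -/
structure StereographicProjection (S : TwoSphere) where
  pole : E3
  pole_mem : pole ∈ S.carrier
  radius : ℝ
  radius_pos : 0 < radius
  e₁ : E3
  e₂ : E3
  e₁_mem : e₁ ∈ S.tangentSpace pole
  e₂_mem : e₂ ∈ S.tangentSpace pole
  norm_e₁ : ‖e₁‖ = 1
  norm_e₂ : ‖e₂‖ = 1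
  orthogonal : inner ℝ e₁ e₂ = 0

namespace StereographicProjection

variable {S : TwoSphere} (p : StereographicProjection S)

/-- The value of the projection; the same formula is used at all points of `ℝ³ ∖ {N}`. -/
def proj (v : E3) : ℂ :=
  ⟨inner ℝ p.e₁ (EuclideanGeometry.inversion p.pole p.radius v),
    inner ℝ p.e₂ (EuclideanGeometry.inversion p.pole p.radius v)⟩

/-- The differential of the projection at `v`. -/
def dproj (v : E3) : E3 →L[ℝ] ℂ := fderiv ℝ p.proj v

end StereographicProjection

/-- The cross ratio `(z₁, z₂; z₃, z₄)`. -/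
def crossRatio (z₁ z₂ z₃ z₄ : ℂ) : ℂ :=
  ((z₁ - z₃) / (z₁ - z₄)) / ((z₂ - z₃) / (z₂ - z₄))

/-- `ω` is the coefficient with respect to `ds dt`, at the parameters `(s, t)`, of the
infinitesimal cross ratio: `S` is a sphere tangent to the knot at `x = K(s)` and `y = K(t)`, it is
projected stereographically to `ℂ` from a point other than `x` and `y`, and `ω` is the
leading coefficient of the cross ratio `(x̃ + dx̃, ỹ; x̃, ỹ + dỹ)` for `x̃`, `ỹ` the
projections of `x`, `y` and `dx̃ = dp_x(K'(s)) ds`, `dỹ = dp_y(K'(t)) dt`. The orientation of the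
sphere is the one that makes the imaginary part non-negative. -/
def IsInfinitesimalCrossRatio (K : Knot) (s t : ℝ) (ω : ℂ) : Prop :=
  0 ≤ ω.im ∧
  ∃ (S : TwoSphere) (p : StereographicProjection S),
    S.IsTangentAt K s ∧ S.IsTangentAt K t ∧
    p.pole ≠ K.toFun s ∧ p.pole ≠ K.toFun t ∧
    Filter.Tendsto
      (fun d : ℝ × ℝ =>
        crossRatio
            (p.proj (K.toFun s) + d.1 • p.dproj (K.toFun s) (K.velocity s))
            (p.proj (K.toFun t))
            (p.proj (K.toFun s))
            (p.proj (K.toFun t) + d.2 • p.dproj (K.toFun t) (K.velocity t)) /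
          ((d.1 * d.2 : ℝ) : ℂ))
      (𝓝[≠] (0 : ℝ) ×ˢ 𝓝[≠] (0 : ℝ)) (𝓝 ω)

open Classical in
/-- The infinitesimal cross ratio `Ω_K` of the knot, as the coefficient with respect to `ds dt`. -/
def infinitesimalCrossRatio (K : Knot) (s t : ℝ) : ℂ :=
  if h : ∃ ω, IsInfinitesimalCrossRatio K s t ω then h.choose else 0

/-- The coefficient with respect to `ds dt` of `|Ω_K| - Re Ω_K`. -/
def crossRatioIntegrand (K : Knot) (p : ℝ × ℝ) : ℝ :=
  ‖infinitesimalCrossRatio K p.1 p.2‖ - (infinitesimalCrossRatio K p.1 p.2).re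

end

/-! Stereographic projection is an inversion followed by isometric coordinates on a plane. Inversion
multiplies infinitesimal lengths and distances by matching factors, so |Ω| is ‖u‖‖v‖ / ‖x - y‖² for
the velocities u, v. The real part of Ω is the mixed derivative of log ‖x - y‖ along u and v
(`logKernel`), also invariant under inversion. Neither quantity sees the sphere or the projection,
and with the sign of the imaginary part they determine Ω (`existsUnique_isInfinitesimalCrossRatio`).

In the difference of the two integrands the chord terms cancel, leaving `logKernel` minus ‖u‖‖v‖ /
d_K². For fixed s both pieces have explicit antiderivatives in t: `logDeriv`, and ± ‖u‖ over the
length of the shorter arc. On each side of the antipode of s the singularities cancel at the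
diagonal, and the `logDeriv` values at the antipode cancel between the sides. What remains is
4‖K'(s)‖ / L (`integral_integrand_sub`), whose integral over s is 4, compensating the -4 in the
energy.

The analytic input is that the unit tangent of a C² knot is Lipschitz in arc length. An arc of
length h therefore has a chord whose projection on either end tangent is at least h - O(h³), which
bounds both integrands (`exists_integrand_bound`) and gives the limits at the diagonal
(`exists_logDeriv_bound`). -/

noncomputable section

/-! ### Plane coordinates and normals of spheres -/

/-- The `ℂ`-valued coordinate map attached to a pair of vectors of `ℝ³`. -/
def complexCoord (e₁ e₂ : E3) : E3 →L[ℝ] ℂ :=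
  (innerSL ℝ e₁).smulRight (1 : ℂ) + (innerSL ℝ e₂).smulRight Complex.I

lemma complexCoord_apply (e₁ e₂ z : E3) :
    complexCoord e₁ e₂ z = ⟨inner ℝ e₁ z, inner ℝ e₂ z⟩ := by
  apply Complex.ext <;> simp [complexCoord]

/-- In `ℝ³`, the inner product of two vectors, one of which is orthogonal to `n ≠ 0`, is computed
from their coordinates with respect to an orthonormal pair orthogonal to `n`. -/
lemma inner_eq_of_orthonormal_pair {e₁ e₂ n z z' : E3} (hn : n ≠ 0) (h₁ : ‖e₁‖ = 1)
    (h₂ : ‖e₂‖ = 1) (h₁₂ : inner ℝ e₁ e₂ = 0) (hn₁ : inner ℝ n e₁ = 0) (hn₂ : inner ℝ n e₂ = 0)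
    (hz : inner ℝ n z = 0) :
    inner ℝ z z' = inner ℝ e₁ z * inner ℝ e₁ z' + inner ℝ e₂ z * inner ℝ e₂ z' := by
  have hn' : ‖n‖ ≠ 0 := norm_ne_zero_iff.mpr hn
  have ho : Orthonormal ℝ ![e₁, e₂, ‖n‖⁻¹ • n] := by
    rw [orthonormal_iff_ite]
    intro i j
    have h₂₁ : inner ℝ e₂ e₁ = 0 := by rw [real_inner_comm]; exact h₁₂
    have hn₁' : inner ℝ e₁ n = 0 := by rw [real_inner_comm]; exact hn₁
    have hn₂' : inner ℝ e₂ n = 0 := by rw [real_inner_comm]; exact hn₂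
    fin_cases i <;> fin_cases j <;>
      simp [h₁, h₂, h₁₂, h₂₁, hn₁, hn₂, hn₁', hn₂', inner_smul_left, inner_smul_right,
        norm_smul, hn']
  have hb : ⊤ ≤ Submodule.span ℝ (Set.range ![e₁, e₂, ‖n‖⁻¹ • n]) :=
    (ho.linearIndependent.span_eq_top_of_card_eq_finrank' (by simp)).ge
  have := (OrthonormalBasis.mk ho hb).sum_inner_mul_inner z z'
  rw [← this]
  simp [Fin.sum_univ_three, inner_smul_right, real_inner_comm, hz]

namespace TwoSphere

variable (S : TwoSphere)

lemma mem_tangentSpace {v w : E3} : w ∈ S.tangentSpace v ↔ inner ℝ (S.a • v + S.b) w = 0 :=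
  Submodule.mem_orthogonal_singleton_iff_inner_right

/-- On the sphere ‖a v + b‖² equals ‖b‖² - a c, which is positive by nondegeneracy. -/
lemma normal_ne_zero {v : E3} (hv : v ∈ S.carrier) : S.a • v + S.b ≠ 0 := by
  intro h
  have h1 : ‖S.a • v + S.b‖ ^ 2 = 0 := by rw [h]; simp
  rw [norm_add_sq_real, norm_smul, inner_smul_left, real_inner_comm] at h1
  simp only [conj_trivial, mul_pow, Real.norm_eq_abs, sq_abs] at h1
  have h2 := S.nondegenerate
  have h3 : S.a * ‖v‖ ^ 2 + 2 * inner ℝ S.b v + S.c = 0 := hv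
  have h4 : S.a * (S.a * ‖v‖ ^ 2 + 2 * inner ℝ S.b v + S.c) = 0 := by rw [h3, mul_zero]
  nlinarith

/-- The equation of the sphere in coordinates centred at one of its points. -/
lemma inner_normal_sub {N x : E3} (hN : N ∈ S.carrier) (hx : x ∈ S.carrier) :
    2 * inner ℝ (S.a • N + S.b) (x - N) = - S.a * ‖x - N‖ ^ 2 := by
  have h1 : S.a * ‖N‖ ^ 2 + 2 * inner ℝ S.b N + S.c = 0 := hN
  have h2 : S.a * ‖x‖ ^ 2 + 2 * inner ℝ S.b x + S.c = 0 := hx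
  rw [norm_sub_sq_real, inner_add_left, inner_sub_right, inner_sub_right, inner_smul_left,
    inner_smul_left, real_inner_self_eq_norm_sq, real_inner_comm x N]
  simp only [conj_trivial]
  linarith

end TwoSphere

/-! ### Inversions and Möbius invariance -/

/-- The differential at `N + X` of the inversion with centre `N` and radius `r`, applied to `u`. -/
def inversionDeriv (r : ℝ) (X u : E3) : E3 :=
  (r / ‖X‖) ^ 2 • (u - (2 * inner ℝ X u / ‖X‖ ^ 2) • X)

lemma hasFDerivAt_inversion_apply {N x : E3} (r : ℝ) (h : x ≠ N) (u : E3) :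
    fderiv ℝ (EuclideanGeometry.inversion N r) x u = inversionDeriv r (x - N) u := by
  rw [(EuclideanGeometry.hasFDerivAt_inversion h).fderiv, inversionDeriv, dist_eq_norm]
  simp only [smul_apply]
  congr 1
  change (ℝ ∙ (x - N))ᗮ.reflection u = _
  rw [Submodule.reflection_orthogonal_apply, Submodule.reflection_singleton_apply]
  simp only [neg_sub, two_smul, ← add_smul]
  congr 2
  simp; ring

/-- The differential is a reflection scaled by (r / ‖X‖)². -/
lemma inversionDeriv_norm (r : ℝ) {X : E3} (hX : X ≠ 0) (u : E3) :
    ‖inversionDeriv r X u‖ = (r / ‖X‖) ^ 2 * ‖u‖ := by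
  have hX' : ‖X‖ ≠ 0 := norm_ne_zero_iff.mpr hX
  rw [inversionDeriv, norm_smul, Real.norm_eq_abs, abs_of_nonneg (by positivity)]
  congr 1
  rw [← sq_eq_sq₀ (norm_nonneg _) (norm_nonneg _), norm_sub_sq_real, norm_smul, inner_smul_right,
    mul_pow, Real.norm_eq_abs, sq_abs, real_inner_comm]
  field_simp
  ring

lemma inversion_sub_inversion {N x y : E3} (r : ℝ) :
    EuclideanGeometry.inversion N r x - EuclideanGeometry.inversion N r y =
      (r / ‖x - N‖) ^ 2 • (x - N) - (r / ‖y - N‖) ^ 2 • (y - N) := by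
  simp [EuclideanGeometry.inversion, dist_eq_norm]

/-- The mixed second derivative of `log ‖x - y‖` in the directions `u` (at `x`) and `v` (at `y`),
as a function of `w = x - y`. -/
def logKernel (w u v : E3) : ℝ :=
  (2 * inner ℝ u w * inner ℝ v w - inner ℝ u v * ‖w‖ ^ 2) / ‖w‖ ^ 4

lemma sub_inversion_norm_sq (r : ℝ) {X Y : E3} (hX : X ≠ 0) (hY : Y ≠ 0) :
    ‖(r / ‖X‖) ^ 2 • X - (r / ‖Y‖) ^ 2 • Y‖ ^ 2 =
      r ^ 4 * ‖X - Y‖ ^ 2 / (‖X‖ ^ 2 * ‖Y‖ ^ 2) := by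
  have hX' : ‖X‖ ≠ 0 := norm_ne_zero_iff.mpr hX
  have hY' : ‖Y‖ ≠ 0 := norm_ne_zero_iff.mpr hY
  rw [norm_sub_sq_real, norm_sub_sq_real, norm_smul, norm_smul, inner_smul_left, inner_smul_right]
  simp only [conj_trivial, mul_pow, Real.norm_eq_abs, sq_abs]
  field_simp
  ring

/-- Möbius invariance of the mixed second derivative of `log ‖x - y‖`. -/
lemma logKernel_inversion {r : ℝ} (hr : r ≠ 0) {X Y : E3} (hX : X ≠ 0) (hY : Y ≠ 0) (h : X ≠ Y)
    (u v : E3) :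
    logKernel ((r / ‖X‖) ^ 2 • X - (r / ‖Y‖) ^ 2 • Y) (inversionDeriv r X u)
      (inversionDeriv r Y v) = logKernel (X - Y) u v := by
  have hX' : ‖X‖ ≠ 0 := norm_ne_zero_iff.mpr hX
  have hY' : ‖Y‖ ≠ 0 := norm_ne_zero_iff.mpr hY
  have hw : ‖X - Y‖ ≠ 0 := norm_ne_zero_iff.mpr (sub_ne_zero.mpr h)
  have e4 : ∀ z : E3, ‖z‖ ^ 4 = (‖z‖ ^ 2) ^ 2 := fun z => by ring
  have hw2 : ‖X‖ ^ 2 - 2 * inner ℝ X Y + ‖Y‖ ^ 2 ≠ 0 := by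
    rw [← norm_sub_sq_real]; positivity
  -- Conceptually, inversion changes log ‖X - Y‖ by a function of X plus a function of Y, which a
  -- mixed derivative kills. Here this is checked as a rational identity in norms and inner
  -- products; `hw2` says that its denominator ‖X - Y‖² is nonzero.
  unfold logKernel
  rw [e4, e4, sub_inversion_norm_sq r hX hY, norm_sub_sq_real]
  simp only [inversionDeriv, inner_sub_left, inner_sub_right, inner_smul_left, inner_smul_right,
    conj_trivial, real_inner_self_eq_norm_sq, real_inner_comm X u, real_inner_comm Y u,
    real_inner_comm X v, real_inner_comm Y v, real_inner_comm X Y]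
  generalize ‖X‖ = α at *
  generalize ‖Y‖ = β at *
  generalize inner ℝ X Y = γ at *
  generalize inner ℝ X u = a at *
  generalize inner ℝ Y u = b at *
  generalize inner ℝ X v = c at *
  generalize inner ℝ Y v = d at *
  field_simp
  ring

/-! ### The cross ratio coefficient in stereographic coordinates -/

namespace StereographicProjection

variable {S : TwoSphere} (p : StereographicProjection S)

lemma proj_eq_complexCoord (v : E3) :
    p.proj v = complexCoord p.e₁ p.e₂ (EuclideanGeometry.inversion p.pole p.radius v) :=
  (complexCoord_apply _ _ _).symm

lemma dproj_apply {x : E3} (hx : x ≠ p.pole) (u : E3) :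
    p.dproj x u = complexCoord p.e₁ p.e₂ (inversionDeriv p.radius (x - p.pole) u) := by
  rw [← hasFDerivAt_inversion_apply p.radius hx, dproj]
  have h : p.proj = complexCoord p.e₁ p.e₂ ∘ EuclideanGeometry.inversion p.pole p.radius :=
    funext p.proj_eq_complexCoord
  have hd := (EuclideanGeometry.hasFDerivAt_inversion (R := p.radius) hx).differentiableAt
  rw [h, ((complexCoord p.e₁ p.e₂).hasFDerivAt.comp x hd.hasFDerivAt).fderiv]
  rfl

/-- With n the normal at the pole and X = x - N, tangency gives ⟨n, u⟩ = -a⟨X, u⟩ and the sphere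
equation gives ⟨n, X⟩ = -a‖X‖² / 2, so the two contributions cancel. -/
lemma inner_normal_inversionDeriv {x u : E3} (hxS : x ∈ S.carrier) (hx : x ≠ p.pole)
    (hu : u ∈ S.tangentSpace x) :
    inner ℝ (S.a • p.pole + S.b) (inversionDeriv p.radius (x - p.pole) u) = 0 := by
  have h1 := S.inner_normal_sub p.pole_mem hxS
  rw [S.mem_tangentSpace] at hu
  have h2 : S.a • x + S.b = (S.a • p.pole + S.b) + S.a • (x - p.pole) := by module
  rw [h2, inner_add_left, inner_smul_left, conj_trivial] at hu
  have hX : ‖x - p.pole‖ ≠ 0 := norm_ne_zero_iff.mpr (sub_ne_zero.mpr hx)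
  have h3 : inner ℝ (S.a • p.pole + S.b) (x - p.pole) = - S.a * ‖x - p.pole‖ ^ 2 / 2 := by
    linarith
  rw [inversionDeriv, inner_smul_right, inner_sub_right, inner_smul_right, h3]
  apply mul_eq_zero_of_right
  field_simp
  linarith

/-- Inversion at the pole flattens the sphere: ⟨n, (r / ‖X‖)² X⟩ = -a r² / 2 for every point. -/
lemma inner_normal_inversion_sub {x y : E3} (hxS : x ∈ S.carrier) (hx : x ≠ p.pole)
    (hyS : y ∈ S.carrier) (hy : y ≠ p.pole) :
    inner ℝ (S.a • p.pole + S.b) ((p.radius / ‖x - p.pole‖) ^ 2 • (x - p.pole) -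
      (p.radius / ‖y - p.pole‖) ^ 2 • (y - p.pole)) = 0 := by
  have hX : ‖x - p.pole‖ ≠ 0 := norm_ne_zero_iff.mpr (sub_ne_zero.mpr hx)
  have hY : ‖y - p.pole‖ ≠ 0 := norm_ne_zero_iff.mpr (sub_ne_zero.mpr hy)
  have h1 := S.inner_normal_sub p.pole_mem hxS
  have h2 := S.inner_normal_sub p.pole_mem hyS
  have h3 : inner ℝ (S.a • p.pole + S.b) (x - p.pole) = - S.a * ‖x - p.pole‖ ^ 2 / 2 := by
    linarith
  have h4 : inner ℝ (S.a • p.pole + S.b) (y - p.pole) = - S.a * ‖y - p.pole‖ ^ 2 / 2 := by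
    linarith
  rw [inner_sub_right, inner_smul_right, inner_smul_right, h3, h4]
  field_simp
  ring

/-- The coordinates on the image plane are isometric. -/
lemma inner_eq_coord {z z' : E3} (hz : inner ℝ (S.a • p.pole + S.b) z = 0) :
    inner ℝ z z' = inner ℝ p.e₁ z * inner ℝ p.e₁ z' + inner ℝ p.e₂ z * inner ℝ p.e₂ z' :=
  inner_eq_of_orthonormal_pair (S.normal_ne_zero p.pole_mem) p.norm_e₁ p.norm_e₂ p.orthogonal
    ((S.mem_tangentSpace).1 p.e₁_mem) ((S.mem_tangentSpace).1 p.e₂_mem) hz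

lemma norm_complexCoord {z : E3} (hz : inner ℝ (S.a • p.pole + S.b) z = 0) :
    ‖complexCoord p.e₁ p.e₂ z‖ = ‖z‖ := by
  rw [← sq_eq_sq₀ (norm_nonneg _) (norm_nonneg _), ← Complex.normSq_eq_norm_sq,
    ← real_inner_self_eq_norm_sq, p.inner_eq_coord hz, complexCoord_apply, Complex.normSq_mk]

/-- For complex numbers, Re(u v w̄²) = 2⟨u, w⟩⟨v, w⟩ - ⟨u, v⟩|w|², and the coordinates preserve
inner products in the plane. -/
lemma re_complexCoord_mul_div {u v w : E3} (hu : inner ℝ (S.a • p.pole + S.b) u = 0)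
    (hv : inner ℝ (S.a • p.pole + S.b) v = 0) (hw : inner ℝ (S.a • p.pole + S.b) w = 0) :
    (complexCoord p.e₁ p.e₂ u * complexCoord p.e₁ p.e₂ v / complexCoord p.e₁ p.e₂ w ^ 2).re =
      logKernel w u v := by
  have hw4 : Complex.normSq (complexCoord p.e₁ p.e₂ w ^ 2) = ‖w‖ ^ 4 := by
    rw [map_pow, Complex.normSq_eq_norm_sq, p.norm_complexCoord hw]; ring
  rw [Complex.div_re, hw4, logKernel, ← add_div]
  congr 1
  rw [← real_inner_self_eq_norm_sq, p.inner_eq_coord hu, p.inner_eq_coord hv, p.inner_eq_coord hw,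
    p.inner_eq_coord hu]
  simp only [complexCoord_apply, pow_two, Complex.mul_re, Complex.mul_im]
  ring

/-- The coefficient of the leading term of the cross ratio, computed with the projection `p`. -/
def crossRatioCoeff (x y u v : E3) : ℂ :=
  p.dproj x u * p.dproj y v / (p.proj x - p.proj y) ^ 2

lemma proj_sub_proj (x y : E3) :
    p.proj x - p.proj y = complexCoord p.e₁ p.e₂ ((p.radius / ‖x - p.pole‖) ^ 2 • (x - p.pole) -
      (p.radius / ‖y - p.pole‖) ^ 2 • (y - p.pole)) := by
  rw [p.proj_eq_complexCoord, p.proj_eq_complexCoord, ← map_sub, inversion_sub_inversion]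

lemma proj_sub_ne_zero {x y : E3} (hxS : x ∈ S.carrier) (hx : x ≠ p.pole)
    (hyS : y ∈ S.carrier) (hy : y ≠ p.pole) (hxy : x ≠ y) : p.proj x - p.proj y ≠ 0 := by
  rw [p.proj_sub_proj, ← norm_ne_zero_iff,
    p.norm_complexCoord (p.inner_normal_inversion_sub hxS hx hyS hy), norm_ne_zero_iff,
    ← inversion_sub_inversion, sub_ne_zero]
  exact (EuclideanGeometry.inversion_injective _ p.radius_pos.ne').ne hxy

/-- The factors (r / ‖X‖)² and (r / ‖Y‖)² from the differentials are exactly cancelled by the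
distortion of the squared distance. -/
lemma norm_crossRatioCoeff {x y u v : E3} (hxS : x ∈ S.carrier) (hx : x ≠ p.pole)
    (hyS : y ∈ S.carrier) (hy : y ≠ p.pole) (hxy : x ≠ y) (hu : u ∈ S.tangentSpace x)
    (hv : v ∈ S.tangentSpace y) :
    ‖p.crossRatioCoeff x y u v‖ = ‖u‖ * ‖v‖ / ‖x - y‖ ^ 2 := by
  have hX : x - p.pole ≠ 0 := sub_ne_zero.mpr hx
  have hY : y - p.pole ≠ 0 := sub_ne_zero.mpr hy
  have hX' : ‖x - p.pole‖ ≠ 0 := norm_ne_zero_iff.mpr hX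
  have hY' : ‖y - p.pole‖ ≠ 0 := norm_ne_zero_iff.mpr hY
  have hw : ‖x - y‖ ≠ 0 := norm_ne_zero_iff.mpr (sub_ne_zero.mpr hxy)
  have hr := p.radius_pos.ne'
  rw [crossRatioCoeff, norm_div, norm_mul, norm_pow, p.proj_sub_proj, p.dproj_apply hx,
    p.dproj_apply hy, p.norm_complexCoord (p.inner_normal_inversion_sub hxS hx hyS hy),
    p.norm_complexCoord (p.inner_normal_inversionDeriv hxS hx hu),
    p.norm_complexCoord (p.inner_normal_inversionDeriv hyS hy hv), inversionDeriv_norm _ hX,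
    inversionDeriv_norm _ hY, sub_inversion_norm_sq _ hX hY, sub_sub_sub_cancel_right]
  field_simp

lemma re_crossRatioCoeff {x y u v : E3} (hxS : x ∈ S.carrier) (hx : x ≠ p.pole)
    (hyS : y ∈ S.carrier) (hy : y ≠ p.pole) (hxy : x ≠ y) (hu : u ∈ S.tangentSpace x)
    (hv : v ∈ S.tangentSpace y) :
    (p.crossRatioCoeff x y u v).re = logKernel (x - y) u v := by
  rw [crossRatioCoeff, p.proj_sub_proj, p.dproj_apply hx, p.dproj_apply hy,
    p.re_complexCoord_mul_div (p.inner_normal_inversionDeriv hxS hx hu)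
      (p.inner_normal_inversionDeriv hyS hy hv) (p.inner_normal_inversion_sub hxS hx hyS hy),
    logKernel_inversion p.radius_pos.ne' (sub_ne_zero.mpr hx) (sub_ne_zero.mpr hy)
      (fun h => hxy (sub_left_injective h)), sub_sub_sub_cancel_right]

end StereographicProjection

/-! ### Existence and uniqueness of the infinitesimal cross ratio -/

/-- The leading coefficient of the cross ratio of two infinitesimal steps. -/
lemma tendsto_crossRatio_div {X Y U V : ℂ} (h : X - Y ≠ 0) :
    Filter.Tendsto (fun d : ℝ × ℝ => crossRatio (X + d.1 • U) Y X (Y + d.2 • V) /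
      ((d.1 * d.2 : ℝ) : ℂ)) (𝓝[≠] (0 : ℝ) ×ˢ 𝓝[≠] (0 : ℝ)) (𝓝 (U * V / (X - Y) ^ 2)) := by
  -- Off the axes the quotient equals this expression exactly, and it is continuous at the origin
  -- because X ≠ Y.
  have hc : Filter.Tendsto (fun d : ℝ × ℝ =>
      U * V / ((X - Y) * (X - Y + (d.1 • U - d.2 • V))))
      (𝓝[≠] (0 : ℝ) ×ˢ 𝓝[≠] (0 : ℝ)) (𝓝 (U * V / (X - Y) ^ 2)) := by
    have : ContinuousAt (fun d : ℝ × ℝ =>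
        U * V / ((X - Y) * (X - Y + (d.1 • U - d.2 • V)))) (0, 0) := by
      refine ContinuousAt.div (by fun_prop) (by fun_prop) ?_
      simpa using h
    have h2 := this.tendsto
    simp only [zero_smul, sub_zero, add_zero, ← pow_two] at h2
    refine h2.mono_left ?_
    rw [nhds_prod_eq]
    exact Filter.prod_mono nhdsWithin_le_nhds nhdsWithin_le_nhds
  refine hc.congr' ?_
  have hne : ∀ᶠ d : ℝ × ℝ in 𝓝[≠] (0 : ℝ) ×ˢ 𝓝[≠] (0 : ℝ), d.1 ≠ 0 ∧ d.2 ≠ 0 :=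
    Filter.Eventually.prod_mk (self_mem_nhdsWithin) (self_mem_nhdsWithin)
  filter_upwards [hne] with d hd
  have h1 : (d.1 : ℂ) ≠ 0 := by exact_mod_cast hd.1
  have h2 : (d.2 : ℂ) ≠ 0 := by exact_mod_cast hd.2
  simp only [crossRatio, Complex.real_smul, Complex.ofReal_mul]
  have e1 : X + d.1 * U - X = d.1 * U := by ring
  have e2 : Y - (Y + d.2 * V) = -(d.2 * V) := by ring
  have e3 : Y - X = -(X - Y) := by ring
  have e4 : X + d.1 * U - (Y + d.2 * V) = X - Y + (d.1 * U - d.2 * V) := by ring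
  rw [e1, e2, e3, e4, neg_div_neg_eq, div_div_div_eq, div_div,
    ← mul_div_mul_left _ _ (mul_ne_zero h1 h2)]
  congr 1 <;> ring

lemma IsInfinitesimalCrossRatio.norm_and_re {K : Knot} {s t : ℝ} {ω : ℂ}
    (h : IsInfinitesimalCrossRatio K s t ω) (hst : K.toFun s ≠ K.toFun t) :
    ‖ω‖ = ‖K.velocity s‖ * ‖K.velocity t‖ / ‖K.toFun s - K.toFun t‖ ^ 2 ∧
    ω.re = logKernel (K.toFun s - K.toFun t) (K.velocity s) (K.velocity t) := by
  obtain ⟨-, S, p, hs, ht, hps, hpt, hlim⟩ := h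
  have hω : ω = p.crossRatioCoeff (K.toFun s) (K.toFun t) (K.velocity s) (K.velocity t) :=
    tendsto_nhds_unique hlim
      (tendsto_crossRatio_div (p.proj_sub_ne_zero hs.1 hps.symm ht.1 hpt.symm hst))
  rw [hω]
  exact ⟨p.norm_crossRatioCoeff hs.1 hps.symm ht.1 hpt.symm hst hs.2 ht.2,
    p.re_crossRatioCoeff hs.1 hps.symm ht.1 hpt.symm hst hs.2 ht.2⟩

lemma Complex.eq_of_norm_eq_of_re_eq {z w : ℂ} (hn : ‖z‖ = ‖w‖) (hr : z.re = w.re)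
    (hz : 0 ≤ z.im) (hw : 0 ≤ w.im) : z = w := by
  refine Complex.ext hr ?_
  have h : Complex.normSq z = Complex.normSq w := by
    rw [Complex.normSq_eq_norm_sq, Complex.normSq_eq_norm_sq, hn]
  rw [Complex.normSq_apply, Complex.normSq_apply, hr] at h
  nlinarith

lemma exists_unit_orthogonal_pair (p q : E3) :
    ∃ w : E3, ‖w‖ = 1 ∧ inner ℝ p w = 0 ∧ inner ℝ q w = 0 := by
  have h : LinearMap.ker ((innerₛₗ ℝ p).prod (innerₛₗ ℝ q)) ≠ ⊥ :=
    LinearMap.ker_ne_bot_of_finrank_lt (by simp)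
  obtain ⟨w, hw, hw0⟩ := Submodule.exists_mem_ne_zero_of_ne_bot h
  have hw' : ‖w‖ ≠ 0 := norm_ne_zero_iff.mpr hw0
  have h2 : inner ℝ p w = 0 ∧ inner ℝ q w = 0 := by simpa using hw
  refine ⟨‖w‖⁻¹ • w, ?_, ?_, ?_⟩
  · simp [norm_smul, hw']
  · simp [inner_smul_right, h2.1]
  · simp [inner_smul_right, h2.2]

/-- A `2`-sphere tangent to given directions at two given points. -/
lemma TwoSphere.exists_tangent {x y : E3} (hxy : x ≠ y) (u v : E3) :
    ∃ S : TwoSphere, (x ∈ S.carrier ∧ u ∈ S.tangentSpace x) ∧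
      (y ∈ S.carrier ∧ v ∈ S.tangentSpace y) := by
  -- Two incidence and two tangency conditions are four linear equations in the five unknowns (a, b,
  -- c), so a nonzero solution exists.
  let f : ℝ × E3 × ℝ →ₗ[ℝ] Fin 4 → ℝ :=
    { toFun := fun q => ![q.1 * ‖x‖ ^ 2 + 2 * inner ℝ q.2.1 x + q.2.2,
        inner ℝ (q.1 • x + q.2.1) u, q.1 * ‖y‖ ^ 2 + 2 * inner ℝ q.2.1 y + q.2.2,
        inner ℝ (q.1 • y + q.2.1) v]
      map_add' := fun q q' => by
        ext i
        fin_cases i <;> simp [inner_add_left, add_smul] <;> ring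
      map_smul' := fun c q => by
        ext i
        fin_cases i <;> simp [inner_add_left, inner_smul_left] <;> ring }
  have h : LinearMap.ker f ≠ ⊥ := LinearMap.ker_ne_bot_of_finrank_lt (by simp)
  obtain ⟨⟨a, b, c⟩, hq, hq0⟩ := Submodule.exists_mem_ne_zero_of_ne_bot h
  rw [LinearMap.mem_ker] at hq
  have h0 : a * ‖x‖ ^ 2 + 2 * inner ℝ b x + c = 0 := congrFun hq 0
  have h1 : inner ℝ (a • x + b) u = 0 := congrFun hq 1
  have h2 : a * ‖y‖ ^ 2 + 2 * inner ℝ b y + c = 0 := congrFun hq 2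
  have h3 : inner ℝ (a • y + b) v = 0 := congrFun hq 3
  -- A vanishing gradient at x would make the equation a‖v - x‖² = 0; as y satisfies it and y ≠ x,
  -- all coefficients would vanish.
  have hn : a • x + b ≠ 0 := by
    intro hn
    have hb : b = -(a • x) := by rw [← sub_eq_zero, sub_neg_eq_add, add_comm, hn]
    have h4 : a * ‖x - y‖ ^ 2 = 0 := by
      rw [hb, inner_neg_left, inner_smul_left, real_inner_self_eq_norm_sq] at h0
      rw [hb, inner_neg_left, inner_smul_left] at h2
      rw [norm_sub_sq_real]
      simp only [conj_trivial] at h0 h2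
      linarith
    have ha : a = 0 := by
      rcases mul_eq_zero.mp h4 with h | h
      · exact h
      · exact absurd (sub_eq_zero.mp (norm_eq_zero.mp (pow_eq_zero_iff two_ne_zero |>.mp h))) hxy
    subst ha
    have hb0 : b = 0 := by simpa using hb
    subst hb0
    have hc : c = 0 := by simpa using h0
    exact hq0 (by simp [hc])
  have hpos : 0 < ‖b‖ ^ 2 - a * c := by
    have h4 : 0 < ‖a • x + b‖ ^ 2 := pow_pos (norm_pos_iff.mpr hn) 2
    rw [norm_add_sq_real, norm_smul, inner_smul_left, real_inner_comm, mul_pow, Real.norm_eq_abs,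
      sq_abs, conj_trivial] at h4
    have h5 : a * (a * ‖x‖ ^ 2 + 2 * inner ℝ b x + c) = 0 := by rw [h0, mul_zero]
    nlinarith
  let S : TwoSphere := ⟨a, b, c, hpos⟩
  exact ⟨S, ⟨h0, S.mem_tangentSpace.2 h1⟩, h2, S.mem_tangentSpace.2 h3⟩

/-- A `2`-sphere has a finite point different from two given ones. -/
lemma TwoSphere.exists_mem_ne (S : TwoSphere) {x y : E3} (hx : x ∈ S.carrier) (hy : y ∈ S.carrier)
    (hxy : x ≠ y) : ∃ N ∈ S.carrier, N ≠ x ∧ N ≠ y := by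
  have h1 : S.a * ‖x‖ ^ 2 + 2 * inner ℝ S.b x + S.c = 0 := hx
  have h2 : S.a * ‖y‖ ^ 2 + 2 * inner ℝ S.b y + S.c = 0 := hy
  by_cases ha : S.a = 0
  -- In a plane, the line through x and y supplies a third point.
  · refine ⟨y + (y - x), ?_, fun h => ?_, fun h => ?_⟩
    · change S.a * ‖_‖ ^ 2 + 2 * inner ℝ S.b _ + S.c = 0
      rw [inner_add_right, inner_sub_right]
      rw [ha] at h1 h2 ⊢
      linarith
    · apply hxy
      have h3 : (2 : ℝ) • (y - x) = 0 := by rw [two_smul, ← sub_eq_zero.mpr h]; abel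
      exact (sub_eq_zero.mp ((smul_eq_zero_iff_right two_ne_zero).mp h3)).symm
    · exact hxy (sub_eq_zero.mp (by simpa using h)).symm
  · set m : E3 := -(S.a⁻¹ • S.b) with hm
    have hmem : ∀ z : E3, z ∈ S.carrier ↔ S.a * ‖z - m‖ ^ 2 = S.a * ‖m‖ ^ 2 - S.c := by
      intro z
      change S.a * ‖z‖ ^ 2 + 2 * inner ℝ S.b z + S.c = 0 ↔ _
      have h3 : S.b = -(S.a • m) := by rw [hm, smul_neg, smul_inv_smul₀ ha, neg_neg]
      rw [h3, norm_sub_sq_real, inner_neg_left, inner_smul_left, real_inner_comm, conj_trivial]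
      constructor <;> intro h <;> linarith
    -- On a round sphere with centre m, move from m by the radius in a direction orthogonal to both
    -- x - m and y - m.
    obtain ⟨w, hw, hwx, hwy⟩ := exists_unit_orthogonal_pair (x - m) (y - m)
    have hxm : S.a • x + S.b = S.a • (x - m) := by
      rw [hm, smul_sub, smul_neg, smul_inv_smul₀ ha, sub_neg_eq_add]
    have hym : S.a • y + S.b = S.a • (y - m) := by
      rw [hm, smul_sub, smul_neg, smul_inv_smul₀ ha, sub_neg_eq_add]
    have hx0 : x - m ≠ 0 := fun h => S.normal_ne_zero hx (by rw [hxm, h, smul_zero])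
    have hy0 : y - m ≠ 0 := fun h => S.normal_ne_zero hy (by rw [hym, h, smul_zero])
    refine ⟨m + ‖x - m‖ • w, ?_, fun h => hx0 ?_, fun h => hy0 ?_⟩
    · rw [hmem, add_sub_cancel_left, norm_smul, hw, mul_one, norm_norm]
      exact (hmem x).1 hx
    · have h3 : inner ℝ (x - m) (‖x - m‖ • w) = 0 := by rw [inner_smul_right, hwx, mul_zero]
      have h4 : ‖x - m‖ • w = x - m := eq_sub_of_add_eq' h
      rwa [h4, inner_self_eq_zero] at h3
    · have h3 : inner ℝ (y - m) (‖x - m‖ • w) = 0 := by rw [inner_smul_right, hwy, mul_zero]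
      have h4 : ‖x - m‖ • w = y - m := eq_sub_of_add_eq' h
      rwa [h4, inner_self_eq_zero] at h3

/-- A sphere can be projected stereographically from any of its finite points. -/
lemma StereographicProjection.exists_pole_eq (S : TwoSphere) {N : E3} (hN : N ∈ S.carrier) :
    ∃ p : StereographicProjection S, p.pole = N := by
  -- Only orthogonality to the normal is required of e₁; the 0 is a vacuous second constraint.
  obtain ⟨e₁, h₁, hn₁, -⟩ := exists_unit_orthogonal_pair (S.a • N + S.b) 0
  obtain ⟨e₂, h₂, hn₂, h₁₂⟩ := exists_unit_orthogonal_pair (S.a • N + S.b) e₁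
  exact ⟨⟨N, hN, 1, one_pos, e₁, e₂, S.mem_tangentSpace.2 hn₁, S.mem_tangentSpace.2 hn₂, h₁, h₂,
    h₁₂⟩, rfl⟩

/-- The stereographic projection with the opposite orientation. -/
def StereographicProjection.conj {S : TwoSphere} (p : StereographicProjection S) :
    StereographicProjection S where
  pole := p.pole
  pole_mem := p.pole_mem
  radius := p.radius
  radius_pos := p.radius_pos
  e₁ := p.e₁
  e₂ := -p.e₂
  e₁_mem := p.e₁_mem
  e₂_mem := neg_mem p.e₂_mem
  norm_e₁ := p.norm_e₁
  norm_e₂ := by rw [norm_neg, p.norm_e₂]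
  orthogonal := by rw [inner_neg_right, p.orthogonal, neg_zero]

lemma complexCoord_neg_right (e₁ e₂ z : E3) :
    complexCoord e₁ (-e₂) z = (starRingEnd ℂ) (complexCoord e₁ e₂ z) := by
  rw [complexCoord_apply, complexCoord_apply]
  apply Complex.ext <;> simp

lemma StereographicProjection.crossRatioCoeff_conj {S : TwoSphere} (p : StereographicProjection S)
    {x y : E3} (hx : x ≠ p.pole) (hy : y ≠ p.pole) (u v : E3) :
    p.conj.crossRatioCoeff x y u v = (starRingEnd ℂ) (p.crossRatioCoeff x y u v) := by
  rw [crossRatioCoeff, crossRatioCoeff, p.conj.dproj_apply hx, p.conj.dproj_apply hy,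
    p.conj.proj_sub_proj, p.dproj_apply hx, p.dproj_apply hy, p.proj_sub_proj]
  simp only [conj, complexCoord_neg_right, map_div₀, map_mul, map_pow]

/-- Reversing the orientation conjugates the coefficient, so one of the two orientations has
non-negative imaginary part. -/
lemma exists_isInfinitesimalCrossRatio {K : Knot} {s t : ℝ} (h : K.toFun s ≠ K.toFun t) :
    ∃ ω, IsInfinitesimalCrossRatio K s t ω := by
  obtain ⟨S, hs, ht⟩ := TwoSphere.exists_tangent h (K.velocity s) (K.velocity t)
  obtain ⟨N, hN, hNs, hNt⟩ := S.exists_mem_ne hs.1 ht.1 h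
  obtain ⟨p, rfl⟩ := StereographicProjection.exists_pole_eq S hN
  have key : ∀ q : StereographicProjection S, q.pole = p.pole →
      0 ≤ (q.crossRatioCoeff (K.toFun s) (K.toFun t) (K.velocity s) (K.velocity t)).im →
      ∃ ω, IsInfinitesimalCrossRatio K s t ω := fun q hq him =>
    ⟨_, him, S, q, hs, ht, hq ▸ hNs, hq ▸ hNt, tendsto_crossRatio_div
      (q.proj_sub_ne_zero hs.1 (hq ▸ hNs.symm) ht.1 (hq ▸ hNt.symm) h)⟩
  rcases le_total 0 (p.crossRatioCoeff (K.toFun s) (K.toFun t) (K.velocity s) (K.velocity t)).im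
    with him | him
  · exact key p rfl him
  · refine key p.conj rfl ?_
    rw [p.crossRatioCoeff_conj hNs.symm hNt.symm, Complex.conj_im]
    linarith

lemma existsUnique_isInfinitesimalCrossRatio {K : Knot} {s t : ℝ} (h : K.toFun s ≠ K.toFun t) :
    ∃! ω, IsInfinitesimalCrossRatio K s t ω := by
  obtain ⟨ω, hω⟩ := exists_isInfinitesimalCrossRatio h
  refine ⟨ω, hω, fun ω' hω' => ?_⟩
  exact Complex.eq_of_norm_eq_of_re_eq ((hω'.norm_and_re h).1.trans (hω.norm_and_re h).1.symm)
    ((hω'.norm_and_re h).2.trans (hω.norm_and_re h).2.symm) hω'.1 hω.1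

lemma crossRatioIntegrand_eq {K : Knot} {s t : ℝ} (h : K.toFun s ≠ K.toFun t) :
    crossRatioIntegrand K (s, t) =
      ‖K.velocity s‖ * ‖K.velocity t‖ / ‖K.toFun s - K.toFun t‖ ^ 2 -
        logKernel (K.toFun s - K.toFun t) (K.velocity s) (K.velocity t) := by
  have hex := exists_isInfinitesimalCrossRatio h
  have hω : IsInfinitesimalCrossRatio K s t (infinitesimalCrossRatio K s t) := by
    rw [infinitesimalCrossRatio, dif_pos hex]
    exact hex.choose_spec
  rw [crossRatioIntegrand, (hω.norm_and_re h).1, (hω.norm_and_re h).2]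

/-! ### Arc length, tangents and chords -/

namespace Knot

variable (K : Knot)

lemma hasDerivAt_toFun (s : ℝ) : HasDerivAt K.toFun (K.velocity s) s :=
  (K.contDiff.differentiable (by norm_num) s).hasDerivAt

lemma contDiff_velocity : ContDiff ℝ 1 K.velocity :=
  ((contDiff_succ_iff_deriv (n := 1)).1 K.contDiff).2.2

lemma continuous_toFun : Continuous K.toFun := K.contDiff.continuous

lemma continuous_velocity : Continuous K.velocity := K.contDiff_velocity.continuous

lemma speed_pos (s : ℝ) : 0 < ‖K.velocity s‖ := norm_pos_iff.mpr (K.immersion s)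

lemma continuous_speed : Continuous fun s => ‖K.velocity s‖ := K.continuous_velocity.norm

lemma toFun_add_one (s : ℝ) : K.toFun (s + 1) = K.toFun s := K.periodic s

lemma velocity_add_one (s : ℝ) : K.velocity (s + 1) = K.velocity s := by
  rw [velocity, ← deriv_comp_add_const, funext K.toFun_add_one]
  rfl

lemma toFun_sub_one (s : ℝ) : K.toFun (s - 1) = K.toFun s := by
  rw [← K.toFun_add_one, sub_add_cancel]

lemma velocity_sub_one (s : ℝ) : K.velocity (s - 1) = K.velocity s := by
  rw [← K.velocity_add_one, sub_add_cancel]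

lemma speed_intervalIntegrable (a b : ℝ) :
    IntervalIntegrable (fun s => ‖K.velocity s‖) MeasureTheory.volume a b :=
  K.continuous_speed.intervalIntegrable a b

lemma arcLength_add (a b c : ℝ) : K.arcLength a b + K.arcLength b c = K.arcLength a c :=
  intervalIntegral.integral_add_adjacent_intervals (K.speed_intervalIntegrable a b)
    (K.speed_intervalIntegrable b c)

lemma arcLength_swap (a b : ℝ) : K.arcLength b a = -K.arcLength a b :=
  intervalIntegral.integral_symm a b

lemma arcLength_pos {a b : ℝ} (h : a < b) : 0 < K.arcLength a b :=
  intervalIntegral.intervalIntegral_pos_of_pos (K.speed_intervalIntegrable a b) K.speed_pos h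

lemma arcLength_nonneg {a b : ℝ} (h : a ≤ b) : 0 ≤ K.arcLength a b :=
  intervalIntegral.integral_nonneg h fun _ _ => norm_nonneg _

lemma arcLength_add_one (a : ℝ) : K.arcLength a (a + 1) = K.length := by
  have h : Function.Periodic (fun s => ‖K.velocity s‖) 1 := fun s => by
    simp only [K.velocity_add_one]
  simpa [length, arcLength] using h.intervalIntegral_add_eq a 0

lemma length_pos : 0 < K.length := K.arcLength_pos one_pos

lemma hasDerivAt_arcLength (a b : ℝ) : HasDerivAt (K.arcLength a) ‖K.velocity b‖ b :=
  intervalIntegral.integral_hasDerivAt_right (K.speed_intervalIntegrable a b)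
    (K.continuous_speed.stronglyMeasurableAtFilter _ _) K.continuous_speed.continuousAt

lemma continuous_arcLength_right (a : ℝ) : Continuous (K.arcLength a) :=
  continuous_iff_continuousAt.2 fun b => (K.hasDerivAt_arcLength a b).continuousAt

lemma continuous_arcLength : Continuous fun p : ℝ × ℝ => K.arcLength p.1 p.2 := by
  have h : (fun p : ℝ × ℝ => K.arcLength p.1 p.2) =
      fun p => K.arcLength 0 p.2 - K.arcLength 0 p.1 := by
    ext p
    rw [← K.arcLength_add 0 p.1 p.2]
    ring
  rw [h]
  exact ((K.continuous_arcLength_right 0).comp continuous_snd).sub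
    ((K.continuous_arcLength_right 0).comp continuous_fst)

lemma arcLength_sub_one (s t : ℝ) : K.arcLength s (t - 1) = K.arcLength s t - K.length := by
  have h := K.arcLength_add_one (t - 1)
  rw [sub_add_cancel] at h
  rw [← h, ← K.arcLength_add s (t - 1) t]
  ring

lemma arcLength_complement (s t : ℝ) : K.arcLength t (s + 1) = K.length - K.arcLength s t := by
  rw [← K.arcLength_add_one s, ← K.arcLength_add s t (s + 1)]
  ring

/-- Equal values force equal fractional parts, but no integer lies strictly between 0 and 1. -/
lemma toFun_ne {a b : ℝ} (hab : a < b) (hb : b < a + 1) : K.toFun a ≠ K.toFun b := by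
  intro h
  have hf : ∀ s, K.toFun (Int.fract s) = K.toFun s := fun s => by
    have := K.periodic.sub_zsmul_eq (x := s) ⌊s⌋
    simpa using this
  rw [← hf a, ← hf b] at h
  have h1 := K.injOn ⟨Int.fract_nonneg a, Int.fract_lt_one a⟩
    ⟨Int.fract_nonneg b, Int.fract_lt_one b⟩ h
  obtain ⟨z, hz⟩ := Int.fract_eq_fract.1 h1.symm
  have hz1 : (0 : ℝ) < z := by linarith
  have hz2 : (z : ℝ) < 1 := by linarith
  have : (0 : ℤ) < z := by exact_mod_cast hz1
  have : z < (1 : ℤ) := by exact_mod_cast hz2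
  omega

lemma toFun_ne_of_mem_offDiagSquare {p : ℝ × ℝ} (hp : p ∈ offDiagSquare) :
    K.toFun p.1 ≠ K.toFun p.2 := fun h => hp.2 (K.injOn hp.1.1 hp.1.2 h)

/-- The unit tangent vector. -/
def tangent (s : ℝ) : E3 := ‖K.velocity s‖⁻¹ • K.velocity s

lemma norm_tangent (s : ℝ) : ‖K.tangent s‖ = 1 := by
  have := (K.speed_pos s).ne'
  simp [tangent, norm_smul, this]

lemma velocity_eq (s : ℝ) : K.velocity s = ‖K.velocity s‖ • K.tangent s := by
  rw [tangent, smul_inv_smul₀ (K.speed_pos s).ne']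

lemma contDiff_tangent : ContDiff ℝ 1 K.tangent :=
  ((K.contDiff_velocity.norm ℝ K.immersion).inv fun s => (K.speed_pos s).ne').smul
    K.contDiff_velocity

lemma chord_eq_integral (a b : ℝ) :
    ∫ u in a..b, K.velocity u = K.toFun b - K.toFun a :=
  intervalIntegral.integral_eq_sub_of_hasDerivAt (fun u _ => K.hasDerivAt_toFun u)
    (K.continuous_velocity.intervalIntegrable a b)

lemma norm_chord_le {a b : ℝ} (hab : a ≤ b) : ‖K.toFun b - K.toFun a‖ ≤ K.arcLength a b := by
  rw [← K.chord_eq_integral]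
  exact intervalIntegral.norm_integral_le_integral_norm hab

lemma inner_chord (e : E3) (a b : ℝ) :
    inner ℝ e (K.toFun b - K.toFun a) = ∫ u in a..b, inner ℝ e (K.velocity u) := by
  rw [← K.chord_eq_integral]
  exact ((innerSL ℝ e).intervalIntegral_comp_comm
    (K.continuous_velocity.intervalIntegrable a b)).symm

/-- The unit tangent vector is Lipschitz with respect to arc length. -/
lemma exists_tangent_lipschitz : ∃ C : ℝ, 0 ≤ C ∧ ∀ a ∈ Set.Icc (0 : ℝ) 2, ∀ b ∈ Set.Icc (0 : ℝ) 2,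
    a ≤ b → ‖K.tangent b - K.tangent a‖ ≤ C * K.arcLength a b := by
  obtain ⟨C, hC⟩ := K.contDiff_tangent.contDiffOn.exists_lipschitzOnWith (s := Set.Icc (0 : ℝ) 2)
    one_ne_zero (convex_Icc 0 2) isCompact_Icc
  -- The positive minimum of the speed converts a Lipschitz bound in the parameter into one in arc
  -- length.
  obtain ⟨m, -, hm⟩ := isCompact_Icc.exists_isMinOn (Set.nonempty_Icc.2 (zero_le_two (α := ℝ)))
    K.continuous_speed.continuousOn
  have hm0 := K.speed_pos m
  refine ⟨C * ‖K.velocity m‖⁻¹, by positivity, fun a ha b hb hab => ?_⟩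
  have h1 := hC.dist_le_mul b hb a ha
  rw [dist_eq_norm, Real.dist_eq, abs_of_nonneg (sub_nonneg.2 hab)] at h1
  have h2 : ‖K.velocity m‖ * (b - a) ≤ K.arcLength a b := by
    have h3 := intervalIntegral.integral_mono_on hab intervalIntegrable_const
      (K.speed_intervalIntegrable a b) (fun u hu => (isMinOn_iff.1 hm) u
        ⟨ha.1.trans hu.1, hu.2.trans hb.2⟩)
    rw [intervalIntegral.integral_const, smul_eq_mul, mul_comm] at h3
    exact h3
  calc _ ≤ C * (b - a) := h1
    _ = C * ‖K.velocity m‖⁻¹ * (‖K.velocity m‖ * (b - a)) := by field_simp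
    _ ≤ _ := by gcongr

/-- For unit tangents ⟨τ_u, τ_c⟩ = 1 - ‖τ_u - τ_c‖² / 2 ≥ 1 - C² l²; integrate this against arc
length. -/
lemma inner_chord_lower {C a b c : ℝ} (hab : a ≤ b)
    (h : ∀ u ∈ Set.Icc a b, ‖K.tangent u - K.tangent c‖ ≤ C * K.arcLength a b) :
    K.arcLength a b - C ^ 2 * K.arcLength a b ^ 3 ≤
      inner ℝ (K.tangent c) (K.toFun b - K.toFun a) := by
  set l := K.arcLength a b with hl
  have hl0 : 0 ≤ l := K.arcLength_nonneg hab
  rw [K.inner_chord]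
  have h1 : l - C ^ 2 * l ^ 3 = ∫ u in a..b, (1 - C ^ 2 * l ^ 2) * ‖K.velocity u‖ := by
    rw [intervalIntegral.integral_const_mul]
    change _ = _ * l
    ring
  rw [h1]
  refine intervalIntegral.integral_mono_on hab
    ((continuous_const.mul K.continuous_speed).intervalIntegrable a b)
    ((continuous_const.inner K.continuous_velocity).intervalIntegrable a b) fun u hu => ?_
  have h2 := norm_sub_sq_real (K.tangent u) (K.tangent c)
  rw [K.norm_tangent, K.norm_tangent] at h2
  have h3 : ‖K.tangent u - K.tangent c‖ ^ 2 ≤ (C * l) ^ 2 :=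
    pow_le_pow_left₀ (norm_nonneg _) (h u hu) 2
  rw [K.velocity_eq u, inner_smul_right, real_inner_comm, norm_smul, K.norm_tangent, norm_norm,
    mul_one, mul_comm]
  refine mul_le_mul_of_nonneg_left ?_ (norm_nonneg _)
  nlinarith [sq_nonneg (C * l)]

/-- A chord is almost as long, in the direction of the tangent vectors at its end points, as the
arc. -/
lemma exists_inner_chord_lower : ∃ C : ℝ, 0 ≤ C ∧ ∀ a ∈ Set.Icc (0 : ℝ) 2,
    ∀ b ∈ Set.Icc (0 : ℝ) 2, a ≤ b →
    K.arcLength a b - C * K.arcLength a b ^ 3 ≤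
      inner ℝ (K.tangent a) (K.toFun b - K.toFun a) ∧
    K.arcLength a b - C * K.arcLength a b ^ 3 ≤
      inner ℝ (K.tangent b) (K.toFun b - K.toFun a) := by
  obtain ⟨C, hC0, hC⟩ := K.exists_tangent_lipschitz
  refine ⟨C ^ 2, sq_nonneg C, fun a ha b hb hab => ⟨?_, ?_⟩⟩
  · refine K.inner_chord_lower hab fun u hu => ?_
    refine (hC a ha u ⟨ha.1.trans hu.1, hu.2.trans hb.2⟩ hu.1).trans ?_
    have := K.arcLength_nonneg hu.2
    have := K.arcLength_add a u b
    gcongr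
    linarith
  · refine K.inner_chord_lower hab fun u hu => ?_
    rw [norm_sub_rev]
    refine (hC u ⟨ha.1.trans hu.1, hu.2.trans hb.2⟩ b hb hu.2).trans ?_
    have := K.arcLength_nonneg hu.1
    have := K.arcLength_add a u b
    gcongr
    linarith

/-- A knot is bi-Lipschitz equivalent to a circle. -/
lemma exists_norm_chord_lower : ∃ c : ℝ, 0 < c ∧ ∀ a ∈ Set.Icc (0 : ℝ) 2,
    ∀ b ∈ Set.Icc (0 : ℝ) 2, a ≤ b → K.arcLength a b ≤ K.length / 2 →
    c * K.arcLength a b ≤ ‖K.toFun b - K.toFun a‖ := by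
  obtain ⟨C, hC0, hC⟩ := K.exists_inner_chord_lower
  have hL := K.length_pos
  -- Below the threshold h₀ = √r the error satisfies C h² ≤ 1/2, so the chord is at least half the
  -- arc. Longer arcs, up to half the knot, form the compact set `D`, on which the chord does not
  -- vanish.
  set r : ℝ := 1 / (2 * (C + 1)) with hr
  have hr0 : 0 < r := by positivity
  set h₀ : ℝ := Real.sqrt r with hh₀
  have hh₀pos : 0 < h₀ := Real.sqrt_pos.2 hr0
  set D : Set (ℝ × ℝ) := (Set.Icc (0 : ℝ) 2 ×ˢ Set.Icc (0 : ℝ) 2) ∩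
    {p | h₀ ≤ K.arcLength p.1 p.2 ∧ K.arcLength p.1 p.2 ≤ K.length / 2} with hD
  have hDc : IsCompact D := (isCompact_Icc.prod isCompact_Icc).inter_right
    ((isClosed_le continuous_const K.continuous_arcLength).inter
      (isClosed_le K.continuous_arcLength continuous_const))
  have hcont : Continuous fun p : ℝ × ℝ => ‖K.toFun p.2 - K.toFun p.1‖ :=
    ((K.continuous_toFun.comp continuous_snd).sub (K.continuous_toFun.comp continuous_fst)).norm
  obtain ⟨δ, hδ, hδD⟩ : ∃ δ > 0, ∀ p ∈ D, δ ≤ ‖K.toFun p.2 - K.toFun p.1‖ := by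
    rcases D.eq_empty_or_nonempty with he | hne
    · exact ⟨1, one_pos, fun p hp => by rw [he] at hp; exact hp.elim⟩
    · obtain ⟨q, hq, hmin⟩ := hDc.exists_isMinOn hne hcont.continuousOn
      refine ⟨_, ?_, fun p hp => isMinOn_iff.1 hmin p hp⟩
      rw [gt_iff_lt, norm_pos_iff, sub_ne_zero]
      have h1 : q.1 < q.2 := by
        by_contra! hle
        have := K.arcLength_nonneg hle
        have := K.arcLength_swap q.2 q.1
        linarith [hq.2.1]
      have h2 : q.2 < q.1 + 1 := by
        by_contra! hle
        have := K.arcLength_nonneg hle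
        have := K.arcLength_add q.1 (q.1 + 1) q.2
        have := K.arcLength_add_one q.1
        linarith [hq.2.2]
      exact (K.toFun_ne h1 h2).symm
  refine ⟨min (1 / 2) (δ / K.length), lt_min (by norm_num) (by positivity),
    fun a ha b hb hab hle => ?_⟩
  have hA := K.arcLength_nonneg hab
  rcases le_total h₀ (K.arcLength a b) with h | h
  · calc _ ≤ δ / K.length * K.length := by
          gcongr
          · exact min_le_right _ _
          · linarith
      _ = δ := by field_simp
      _ ≤ _ := hδD (a, b) ⟨⟨ha, hb⟩, h, hle⟩
  · have h1 := (hC a ha b hb hab).1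
    have h2 := real_inner_le_norm (K.tangent a) (K.toFun b - K.toFun a)
    rw [K.norm_tangent, one_mul] at h2
    have h3 : K.arcLength a b ^ 2 ≤ r := by
      calc _ ≤ h₀ ^ 2 := pow_le_pow_left₀ hA h 2
        _ = r := Real.sq_sqrt hr0.le
    have h4 : C * K.arcLength a b ^ 2 ≤ 1 / 2 := by
      calc _ ≤ (C + 1) * r := by gcongr; linarith
        _ = 1 / 2 := by rw [hr]; field_simp
    calc _ ≤ 1 / 2 * K.arcLength a b := by gcongr; exact min_le_left _ _
      _ ≤ K.arcLength a b - C * K.arcLength a b ^ 3 := by nlinarith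
      _ ≤ _ := h1.trans h2

end Knot

/-! ### Scalar estimates near the diagonal -/

lemma logKernel_neg (w u v : E3) : logKernel (-w) u v = logKernel w u v := by
  simp [logKernel]

lemma logKernel_swap (w u v : E3) : logKernel w v u = logKernel w u v := by
  rw [logKernel, logKernel, real_inner_comm u v]
  ring

lemma logKernel_smul (w u v : E3) (a b : ℝ) :
    logKernel w (a • u) (b • v) = a * b * logKernel w u v := by
  simp only [logKernel, inner_smul_left, inner_smul_right, conj_trivial]
  ring

/-- If `q ≤ δ ≤ h` and `q ≥ h - C h³` then `δ² = h² + O(h⁴)`. -/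
lemma sq_sub_le_of_sub_cube_le {C h δ q : ℝ} (hh : 0 < h) (hq : q ≤ δ)
    (hl : h - C * h ^ 3 ≤ q) : h ^ 2 - 2 * C * h ^ 4 ≤ δ ^ 2 := by
  rcases le_total 0 (h - C * h ^ 3) with h0 | h0
  · have h1 := pow_le_pow_left₀ h0 (hl.trans hq) 2
    nlinarith [sq_nonneg (C * h ^ 3)]
  · have h1 : h * (h - C * h ^ 3) ≤ 0 := mul_nonpos_of_nonneg_of_nonpos hh.le h0
    nlinarith [sq_nonneg δ, sq_nonneg h]

/-- Here h is the arc, δ the chord and q its projection on an end tangent. The numerator h² - δ² is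
O(h⁴), and the denominator is at least c² h⁴. -/
lemma abs_inv_sq_sub_inv_sq_le {C c h δ q : ℝ} (hC : 0 ≤ C) (hc : 0 < c) (hh : 0 < h)
    (hq : q ≤ δ) (hl : h - C * h ^ 3 ≤ q) (hδ : δ ≤ h) (hcδ : c * h ≤ δ) :
    |1 / δ ^ 2 - 1 / h ^ 2| ≤ 2 * C / c ^ 2 := by
  have hδ0 : 0 < δ := lt_of_lt_of_le (by positivity) hcδ
  have h1 := sq_sub_le_of_sub_cube_le hh hq hl
  have h2 := pow_le_pow_left₀ hδ0.le hδ 2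
  have h3 : (c * h) ^ 2 ≤ δ ^ 2 := pow_le_pow_left₀ (by positivity) hcδ 2
  have e : 1 / δ ^ 2 - 1 / h ^ 2 = (h ^ 2 - δ ^ 2) / (δ ^ 2 * h ^ 2) := by field_simp
  rw [e, abs_of_nonneg (div_nonneg (by linarith) (by positivity)),
    div_le_div_iff₀ (by positivity) (by positivity)]
  calc (h ^ 2 - δ ^ 2) * c ^ 2 ≤ (2 * C * h ^ 4) * c ^ 2 := by gcongr; linarith
    _ = 2 * C * ((c * h) ^ 2 * h ^ 2) := by ring
    _ ≤ 2 * C * (δ ^ 2 * h ^ 2) := by gcongr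

/-- Both δ² and h q are h² + O(h⁴), while the common denominator h δ² is at least c² h³. -/
lemma abs_inv_sub_div_sq_le {C c h δ q : ℝ} (hC : 0 ≤ C) (hc : 0 < c) (hh : 0 < h)
    (hq : q ≤ δ) (hl : h - C * h ^ 3 ≤ q) (hδ : δ ≤ h) (hcδ : c * h ≤ δ) :
    |1 / h - q / δ ^ 2| ≤ 2 * C / c ^ 2 * h := by
  have hδ0 : 0 < δ := lt_of_lt_of_le (by positivity) hcδ
  have h1 := sq_sub_le_of_sub_cube_le hh hq hl
  have h2 := pow_le_pow_left₀ hδ0.le hδ 2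
  have h3 : (c * h) ^ 2 ≤ δ ^ 2 := pow_le_pow_left₀ (by positivity) hcδ 2
  have h4 : h * q ≤ h * h := by gcongr; exact hq.trans hδ
  have h5 : h * (h - C * h ^ 3) ≤ h * q := by gcongr
  have h6 : 0 ≤ C * h ^ 4 := by positivity
  have e : 1 / h - q / δ ^ 2 = (δ ^ 2 - h * q) / (h * δ ^ 2) := by field_simp
  have h7 : |δ ^ 2 - h * q| ≤ 2 * C * h ^ 4 := by
    rw [abs_le]; constructor <;> nlinarith
  rw [e, abs_div, abs_of_pos (show 0 < h * δ ^ 2 by positivity), div_le_iff₀ (by positivity)]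
  calc _ ≤ 2 * C * h ^ 4 := h7
    _ = 2 * C / c ^ 2 * h * (h * (c * h) ^ 2) := by field_simp
    _ ≤ _ := by gcongr

lemma abs_inv_sq_sub_logKernel_le {C c h : ℝ} {u v w : E3} (hu : ‖u‖ = 1) (hv : ‖v‖ = 1)
    (hC : 0 ≤ C) (hc : 0 < c) (hh : 0 < h) (hlu : h - C * h ^ 3 ≤ inner ℝ u w)
    (hlv : h - C * h ^ 3 ≤ inner ℝ v w) (hδ : ‖w‖ ≤ h) (hcδ : c * h ≤ ‖w‖) :
    |1 / ‖w‖ ^ 2 - logKernel w u v| ≤ 4 * C / c ^ 4 := by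
  have hδ0 : 0 < ‖w‖ := lt_of_lt_of_le (by positivity) hcδ
  have hqu : |inner ℝ u w| ≤ ‖w‖ := by simpa [hu] using abs_real_inner_le_norm u w
  have hqv : |inner ℝ v w| ≤ ‖w‖ := by simpa [hv] using abs_real_inner_le_norm v w
  have huv : inner ℝ u v ≤ 1 := by simpa [hu, hv] using real_inner_le_norm u v
  -- With Rv the reflection of v in the line of w, this is ‖w‖²(1 - ⟨u, Rv⟩), proportional to ‖u -
  -- Rv‖².
  have h0 : 0 ≤ ‖w‖ ^ 2 * (1 + inner ℝ u v) - 2 * inner ℝ u w * inner ℝ v w := by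
    have h1 : 0 ≤ ‖‖w‖ ^ 2 • (u + v) - (2 * inner ℝ v w) • w‖ ^ 2 := sq_nonneg _
    have h2 : ‖‖w‖ ^ 2 • (u + v) - (2 * inner ℝ v w) • w‖ ^ 2 =
        2 * ‖w‖ ^ 2 * (‖w‖ ^ 2 * (1 + inner ℝ u v) - 2 * inner ℝ u w * inner ℝ v w) := by
      rw [norm_sub_sq_real, norm_smul, norm_smul, mul_pow, mul_pow, norm_add_sq_real, hu, hv]
      simp only [inner_smul_left, inner_smul_right, inner_add_left, conj_trivial,
        Real.norm_eq_abs, sq_abs]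
      ring
    rw [h2] at h1
    exact nonneg_of_mul_nonneg_right h1 (by positivity)
  have h3 : ‖w‖ ^ 2 * (1 + inner ℝ u v) - 2 * inner ℝ u w * inner ℝ v w ≤ 4 * C * h ^ 4 := by
    have h4 := pow_le_pow_left₀ hδ0.le hδ 2
    have h5 : ‖w‖ ^ 2 * (1 + inner ℝ u v) ≤ h ^ 2 * 2 := by
      have : 0 ≤ 1 - inner ℝ u v := by linarith
      nlinarith [sq_nonneg ‖w‖]
    rcases le_total 0 (h - C * h ^ 3) with h6 | h6
    · have h7 := mul_le_mul hlu hlv h6 (h6.trans hlu)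
      nlinarith [sq_nonneg (C * h ^ 3)]
    -- In this case C h² ≥ 1, so the crude bound 4h² on the numerator suffices.
    · have h7 : h * (h - C * h ^ 3) ≤ 0 := mul_nonpos_of_nonneg_of_nonpos hh.le h6
      have h8 : |inner ℝ u w * inner ℝ v w| ≤ ‖w‖ * ‖w‖ := by
        rw [abs_mul]; gcongr
      have h9 := (abs_le.1 h8).1
      nlinarith
  have e : 1 / ‖w‖ ^ 2 - logKernel w u v =
      (‖w‖ ^ 2 * (1 + inner ℝ u v) - 2 * inner ℝ u w * inner ℝ v w) / ‖w‖ ^ 4 := by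
    rw [logKernel]
    field_simp
    ring
  rw [e, abs_of_nonneg (by positivity), div_le_div_iff₀ (by positivity) (by positivity)]
  have h10 : (c * h) ^ 4 ≤ ‖w‖ ^ 4 := pow_le_pow_left₀ (by positivity) hcδ 4
  calc _ ≤ 4 * C * h ^ 4 * c ^ 4 := by gcongr
    _ = 4 * C * (c * h) ^ 4 := by ring
    _ ≤ _ := by gcongr

/-! ### Boundedness and integrability of the integrands -/

namespace Knot

variable (K : Knot)

/-- The function `|Ω_K| - Re Ω_K` in terms of the velocity vectors. -/
def crossRatioKernel (p : ℝ × ℝ) : ℝ :=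
  ‖K.velocity p.1‖ * ‖K.velocity p.2‖ / ‖K.toFun p.1 - K.toFun p.2‖ ^ 2 -
    logKernel (K.toFun p.1 - K.toFun p.2) (K.velocity p.1) (K.velocity p.2)

lemma arcLength_self (s : ℝ) : K.arcLength s s = 0 := intervalIntegral.integral_same

lemma arcDist_self (s : ℝ) : K.arcDist s s = 0 := by
  rw [arcDist, arcLength_self, abs_zero, sub_zero, min_eq_left K.length_pos.le]

lemma arcDist_comm (s t : ℝ) : K.arcDist t s = K.arcDist s t := by
  rw [arcDist, arcDist, K.arcLength_swap s t, abs_neg]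

lemma energyIntegrand_diag (s : ℝ) : K.energyIntegrand (s, s) = 0 := by
  simp [energyIntegrand, arcDist_self]

/-- Division by zero gives 0, so the diagonal needs no null-set argument. -/
lemma crossRatioKernel_diag (s : ℝ) : K.crossRatioKernel (s, s) = 0 := by
  simp [crossRatioKernel, logKernel]

lemma energyIntegrand_swap (s t : ℝ) : K.energyIntegrand (t, s) = K.energyIntegrand (s, t) := by
  simp only [energyIntegrand]
  rw [norm_sub_rev, K.arcDist_comm, mul_comm ‖K.velocity t‖]

lemma crossRatioKernel_swap (s t : ℝ) :
    K.crossRatioKernel (t, s) = K.crossRatioKernel (s, t) := by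
  simp only [crossRatioKernel]
  rw [norm_sub_rev, mul_comm ‖K.velocity t‖, ← neg_sub (K.toFun s), logKernel_neg,
    logKernel_swap]

lemma crossRatioKernel_eq (s t : ℝ) : K.crossRatioKernel (s, t) =
    (1 / ‖K.toFun s - K.toFun t‖ ^ 2 - logKernel (K.toFun s - K.toFun t) (K.tangent s)
      (K.tangent t)) * (‖K.velocity s‖ * ‖K.velocity t‖) := by
  have h := logKernel_smul (K.toFun s - K.toFun t) (K.tangent s) (K.tangent t) ‖K.velocity s‖
    ‖K.velocity t‖
  rw [← K.velocity_eq, ← K.velocity_eq] at h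
  simp only [crossRatioKernel]
  rw [h]
  ring

/-- Two points of a knot are the end points of an arc whose length is their distance. -/
lemma exists_arc {s t : ℝ} (hs : s ∈ Set.Ico (0 : ℝ) 1) (ht : t ∈ Set.Ico (0 : ℝ) 1)
    (hst : s < t) : ∃ a ∈ Set.Icc (0 : ℝ) 1, ∃ b ∈ Set.Icc (0 : ℝ) 2, a < b ∧
    K.arcLength a b = K.arcDist s t ∧ K.arcLength a b ≤ K.length / 2 ∧
    ((K.toFun a = K.toFun s ∧ K.velocity a = K.velocity s ∧ K.toFun b = K.toFun t ∧
      K.velocity b = K.velocity t) ∨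
    (K.toFun a = K.toFun t ∧ K.velocity a = K.velocity t ∧ K.toFun b = K.toFun s ∧
      K.velocity b = K.velocity s)) := by
  have hA := K.arcLength_pos hst
  obtain ⟨hs0, hs1⟩ := hs
  obtain ⟨ht0, ht1⟩ := ht
  rcases le_total (K.arcLength s t) (K.length / 2) with h | h
  · refine ⟨s, ⟨hs0, hs1.le⟩, t, ⟨ht0, by linarith⟩, hst, ?_, h, Or.inl ⟨rfl, rfl, rfl, rfl⟩⟩
    rw [arcDist, abs_of_pos hA, min_eq_left (by linarith)]
  · refine ⟨t, ⟨ht0, ht1.le⟩, s + 1, ⟨by linarith, by linarith⟩, by linarith, ?_, ?_,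
      Or.inr ⟨rfl, rfl, K.toFun_add_one s, K.velocity_add_one s⟩⟩
    · rw [arcDist, abs_of_pos hA, min_eq_right (by linarith), arcLength_complement]
    · rw [arcLength_complement]
      linarith

/-- Both integrands are bounded. -/
lemma exists_integrand_bound : ∃ M : ℝ, ∀ p ∈ square,
    |K.energyIntegrand p| ≤ M ∧ |K.crossRatioKernel p| ≤ M := by
  obtain ⟨C, hC0, hC⟩ := K.exists_inner_chord_lower
  obtain ⟨c, hc0, hc⟩ := K.exists_norm_chord_lower
  obtain ⟨B, hB⟩ := isCompact_Icc.exists_bound_of_continuousOn (s := Set.Icc (0 : ℝ) 1)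
    K.continuous_speed.continuousOn
  set M : ℝ := max (2 * C / c ^ 2) (4 * C / c ^ 4) * (B * B) with hM
  have hB0 : 0 ≤ B := (norm_nonneg _).trans (hB 0 (by simp))
  have hM0 : 0 ≤ M := by positivity
  have key : ∀ s ∈ Set.Ico (0 : ℝ) 1, ∀ t ∈ Set.Ico (0 : ℝ) 1, s < t →
      |K.energyIntegrand (s, t)| ≤ M ∧ |K.crossRatioKernel (s, t)| ≤ M := by
    intro s hs t ht hst
    obtain ⟨a, ha, b, hb, hab, hdist, hle, hor⟩ := K.exists_arc hs ht hst
    have h1 := hC a ⟨ha.1, ha.2.trans one_le_two⟩ b hb hab.le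
    have h2 := hc a ⟨ha.1, ha.2.trans one_le_two⟩ b hb hab.le hle
    have h3 := K.norm_chord_le hab.le
    have h4 := K.arcLength_pos hab
    have h5 := real_inner_le_norm (K.tangent a) (K.toFun b - K.toFun a)
    rw [K.norm_tangent, one_mul] at h5
    have hE := abs_inv_sq_sub_inv_sq_le hC0 hc0 h4 h5 h1.1 h3 h2
    have hQ := abs_inv_sq_sub_logKernel_le (K.norm_tangent a) (K.norm_tangent b) hC0 hc0 h4
      h1.1 h1.2 h3 h2
    have hsp : |‖K.velocity s‖ * ‖K.velocity t‖| ≤ B * B := by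
      rw [abs_mul]
      exact mul_le_mul (hB s ⟨hs.1, hs.2.le⟩) (hB t ⟨ht.1, ht.2.le⟩) (abs_nonneg _) hB0
    have hE' : |1 / ‖K.toFun s - K.toFun t‖ ^ 2 - 1 / K.arcDist s t ^ 2| ≤ 2 * C / c ^ 2 := by
      rw [← hdist]
      rcases hor with ⟨e1, -, e2, -⟩ | ⟨e1, -, e2, -⟩
      · rw [← e1, ← e2, norm_sub_rev]; exact hE
      · rw [← e1, ← e2]; exact hE
    have hQ' : |1 / ‖K.toFun s - K.toFun t‖ ^ 2 - logKernel (K.toFun s - K.toFun t)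
        (K.tangent s) (K.tangent t)| ≤ 4 * C / c ^ 4 := by
      unfold tangent at hQ ⊢
      rcases hor with ⟨e1, e1', e2, e2'⟩ | ⟨e1, e1', e2, e2'⟩
      · rw [← e1, ← e2, ← e1', ← e2', norm_sub_rev, ← neg_sub (K.toFun b), logKernel_neg]
        exact hQ
      · rw [← e1, ← e2, ← e1', ← e2', logKernel_swap]
        exact hQ
    constructor
    · rw [energyIntegrand, abs_mul]
      exact mul_le_mul (hE'.trans (le_max_left _ _)) hsp (abs_nonneg _) (by positivity)
    · rw [crossRatioKernel_eq, abs_mul]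
      exact mul_le_mul (hQ'.trans (le_max_right _ _)) hsp (abs_nonneg _) (by positivity)
  refine ⟨M, fun ⟨s, t⟩ ⟨hs, ht⟩ => ?_⟩
  rcases lt_trichotomy s t with h | h | h
  · exact key s hs t ht h
  · subst h
    rw [energyIntegrand_diag, crossRatioKernel_diag, abs_zero]
    exact ⟨hM0, hM0⟩
  · rw [← energyIntegrand_swap, ← crossRatioKernel_swap]
    exact key t ht s hs h

lemma continuous_arcDist : Continuous fun p : ℝ × ℝ => K.arcDist p.1 p.2 :=
  K.continuous_arcLength.abs.min (continuous_const.sub K.continuous_arcLength.abs)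

lemma measurable_energyIntegrand : Measurable K.energyIntegrand := by
  have h1 := K.continuous_arcDist.measurable
  have h2 := ((K.continuous_toFun.comp continuous_fst).sub
    (K.continuous_toFun.comp continuous_snd)).norm.measurable
  have h3 := ((K.continuous_speed.comp continuous_fst).mul
    (K.continuous_speed.comp continuous_snd)).measurable
  exact (((h2.pow_const 2).const_div 1).sub ((h1.pow_const 2).const_div 1)).mul h3

lemma measurable_crossRatioKernel : Measurable K.crossRatioKernel := by
  have h1 := (K.continuous_toFun.comp (continuous_fst (X := ℝ) (Y := ℝ))).sub
    (K.continuous_toFun.comp (continuous_snd (X := ℝ) (Y := ℝ)))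
  have h2 := K.continuous_velocity.comp (continuous_fst (X := ℝ) (Y := ℝ))
  have h3 := K.continuous_velocity.comp (continuous_snd (X := ℝ) (Y := ℝ))
  refine ((h2.norm.mul h3.norm).measurable.div (h1.norm.pow 2).measurable).sub ?_
  exact ((((continuous_const.mul (h2.inner h1)).mul (h3.inner h1)).sub
    ((h2.inner h3).mul (h1.norm.pow 2))).measurable).div (h1.norm.pow 4).measurable

lemma measurableSet_square : MeasurableSet square := measurableSet_Ico.prod measurableSet_Ico

lemma volume_square_lt_top : MeasureTheory.volume square < ⊤ := by
  rw [square, MeasureTheory.Measure.volume_eq_prod, MeasureTheory.Measure.prod_prod]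
  simp

lemma integrableOn_energyIntegrand : MeasureTheory.IntegrableOn K.energyIntegrand square := by
  obtain ⟨M, hM⟩ := K.exists_integrand_bound
  refine MeasureTheory.Measure.integrableOn_of_bounded volume_square_lt_top.ne
    K.measurable_energyIntegrand.aestronglyMeasurable (M := M) ?_
  exact (MeasureTheory.ae_restrict_mem measurableSet_square).mono fun p hp => (hM p hp).1

lemma integrableOn_crossRatioKernel : MeasureTheory.IntegrableOn K.crossRatioKernel square := by
  obtain ⟨M, hM⟩ := K.exists_integrand_bound
  refine MeasureTheory.Measure.integrableOn_of_bounded volume_square_lt_top.ne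
    K.measurable_crossRatioKernel.aestronglyMeasurable (M := M) ?_
  exact (MeasureTheory.ae_restrict_mem measurableSet_square).mono fun p hp => (hM p hp).2

end Knot

/-! ### Antiderivatives and the integral over one variable -/

namespace Knot

variable (K : Knot)

/-- The derivative in the direction of the velocity at `s` of `log ‖K s - K t‖`, as a function
of `t`. -/
def logDeriv (s t : ℝ) : ℝ :=
  inner ℝ (K.velocity s) (K.toFun s - K.toFun t) / ‖K.toFun s - K.toFun t‖ ^ 2

lemma hasDerivAt_logDeriv {s t : ℝ} (h : K.toFun s ≠ K.toFun t) :
    HasDerivAt (K.logDeriv s)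
      (logKernel (K.toFun s - K.toFun t) (K.velocity s) (K.velocity t)) t := by
  have hw : ‖K.toFun s - K.toFun t‖ ≠ 0 := norm_ne_zero_iff.mpr (sub_ne_zero.mpr h)
  have h1 := (K.hasDerivAt_toFun t).const_sub (K.toFun s)
  have h2 := ((hasDerivAt_const t (K.velocity s)).inner ℝ h1).div h1.norm_sq (pow_ne_zero 2 hw)
  refine h2.congr_deriv ?_
  rw [logKernel, inner_zero_left, add_zero, inner_neg_right, inner_neg_right,
    real_inner_comm (K.toFun s - K.toFun t) (K.velocity t)]
  field_simp
  ring

/-- This antiderivative serves the half where the forward arc from s is the shorter one; the added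
term cancels the pole of `logDeriv` at t = s. -/
lemma hasDerivAt_logDeriv_add {s t : ℝ} (h : K.toFun s ≠ K.toFun t) (hA : K.arcLength s t ≠ 0) :
    HasDerivAt (fun t => K.logDeriv s t + ‖K.velocity s‖ / K.arcLength s t)
      (logKernel (K.toFun s - K.toFun t) (K.velocity s) (K.velocity t) -
        ‖K.velocity s‖ * ‖K.velocity t‖ / K.arcLength s t ^ 2) t := by
  have h1 := (hasDerivAt_const t ‖K.velocity s‖).div (K.hasDerivAt_arcLength s t) hA
  refine ((K.hasDerivAt_logDeriv h).add h1).congr_deriv ?_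
  ring

/-- The counterpart past the antipode, where the shorter arc runs from t to s + 1. -/
lemma hasDerivAt_logDeriv_sub {s t : ℝ} (h : K.toFun s ≠ K.toFun t)
    (hA : K.length - K.arcLength s t ≠ 0) :
    HasDerivAt (fun t => K.logDeriv s t - ‖K.velocity s‖ / (K.length - K.arcLength s t))
      (logKernel (K.toFun s - K.toFun t) (K.velocity s) (K.velocity t) -
        ‖K.velocity s‖ * ‖K.velocity t‖ / (K.length - K.arcLength s t) ^ 2) t := by
  have h1 := (hasDerivAt_const t ‖K.velocity s‖).div
    ((K.hasDerivAt_arcLength s t).const_sub K.length) hA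
  refine ((K.hasDerivAt_logDeriv h).sub h1).congr_deriv ?_
  ring

lemma tangent_add_one (s : ℝ) : K.tangent (s + 1) = K.tangent s := by
  rw [tangent, tangent, velocity_add_one]

/-- `∂ₛ log ‖K s - K t‖` is asymptotic to `∂ₛ log` of the arc length between `s` and `t`. -/
lemma exists_logDeriv_bound : ∃ M : ℝ, ∀ s ∈ Set.Ico (0 : ℝ) 1, ∀ t ∈ Set.Ioo s (s + 1),
    (K.arcLength s t ≤ K.length / 2 →
      |K.logDeriv s t + ‖K.velocity s‖ / K.arcLength s t| ≤
        ‖K.velocity s‖ * (M * K.arcLength s t)) ∧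
    (K.length / 2 ≤ K.arcLength s t →
      |K.logDeriv s t - ‖K.velocity s‖ / (K.length - K.arcLength s t)| ≤
        ‖K.velocity s‖ * (M * (K.length - K.arcLength s t))) := by
  obtain ⟨C, hC0, hC⟩ := K.exists_inner_chord_lower
  obtain ⟨c, hc0, hc⟩ := K.exists_norm_chord_lower
  refine ⟨2 * C / c ^ 2, fun s hs t ht => ?_⟩
  have hs2 : s ∈ Set.Icc (0 : ℝ) 2 := ⟨hs.1, by linarith [hs.2]⟩
  have hs2' : s + 1 ∈ Set.Icc (0 : ℝ) 2 := ⟨by linarith [hs.1], by linarith [hs.2]⟩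
  have ht2 : t ∈ Set.Icc (0 : ℝ) 2 := ⟨hs.1.trans ht.1.le, by linarith [hs.2, ht.2]⟩
  constructor <;> intro hle
  · have h5 := real_inner_le_norm (K.tangent s) (K.toFun t - K.toFun s)
    rw [K.norm_tangent, one_mul] at h5
    have h := abs_inv_sub_div_sq_le hC0 hc0 (K.arcLength_pos ht.1) h5
      (hC s hs2 t ht2 ht.1.le).1 (K.norm_chord_le ht.1.le) (hc s hs2 t ht2 ht.1.le hle)
    have e : K.logDeriv s t + ‖K.velocity s‖ / K.arcLength s t = ‖K.velocity s‖ *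
        (1 / K.arcLength s t - inner ℝ (K.tangent s) (K.toFun t - K.toFun s) /
          ‖K.toFun t - K.toFun s‖ ^ 2) := by
      have e1 : inner ℝ (K.velocity s) (K.toFun s - K.toFun t) =
          -(‖K.velocity s‖ * inner ℝ (K.tangent s) (K.toFun t - K.toFun s)) := by
        rw [← neg_sub (K.toFun t), inner_neg_right, ← real_inner_smul_left, ← K.velocity_eq]
      rw [logDeriv, e1, norm_sub_rev]
      ring
    rw [e, abs_mul, abs_norm]
    gcongr
  -- On the far half the base point is read as the final end point s + 1 of the arc starting at t.
  · have h5 := real_inner_le_norm (K.tangent (s + 1)) (K.toFun (s + 1) - K.toFun t)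
    rw [K.norm_tangent, one_mul] at h5
    have h := abs_inv_sub_div_sq_le hC0 hc0 (K.arcLength_pos ht.2) h5
      (hC t ht2 (s + 1) hs2' ht.2.le).2 (K.norm_chord_le ht.2.le)
      (hc t ht2 (s + 1) hs2' ht.2.le (by rw [arcLength_complement]; linarith))
    rw [arcLength_complement, toFun_add_one, tangent_add_one] at h
    have e : K.logDeriv s t - ‖K.velocity s‖ / (K.length - K.arcLength s t) = -(‖K.velocity s‖ *
        (1 / (K.length - K.arcLength s t) - inner ℝ (K.tangent s) (K.toFun s - K.toFun t) /
          ‖K.toFun s - K.toFun t‖ ^ 2)) := by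
      have e1 : inner ℝ (K.velocity s) (K.toFun s - K.toFun t) =
          ‖K.velocity s‖ * inner ℝ (K.tangent s) (K.toFun s - K.toFun t) := by
        rw [← real_inner_smul_left, ← K.velocity_eq]
      rw [logDeriv, e1]
      ring
    rw [e, abs_neg, abs_mul, abs_norm]
    gcongr

lemma tendsto_logDeriv_add {s : ℝ} (hs : s ∈ Set.Ico (0 : ℝ) 1) :
    Filter.Tendsto (fun t => K.logDeriv s t + ‖K.velocity s‖ / K.arcLength s t) (𝓝[>] s) (𝓝 0) := by
  obtain ⟨M, hM⟩ := K.exists_logDeriv_bound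
  have hc := (K.continuous_arcLength_right s).continuousAt (x := s)
  have hL : K.arcLength s s < K.length / 2 := by
    rw [arcLength_self]; exact half_pos K.length_pos
  have h0 : Filter.Tendsto (fun t => ‖K.velocity s‖ * (M * K.arcLength s t)) (𝓝[>] s) (𝓝 0) := by
    have := ((hc.const_mul M).const_mul ‖K.velocity s‖).tendsto
    rw [arcLength_self, mul_zero, mul_zero] at this
    exact this.mono_left nhdsWithin_le_nhds
  refine squeeze_zero_norm' ?_ h0
  filter_upwards [Ioo_mem_nhdsGT (show s < s + 1 by linarith),
    nhdsWithin_le_nhds (hc.eventually_lt_const hL)] with t ht htL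
  exact (hM s hs t ht).1 htL.le

lemma tendsto_logDeriv_sub {s : ℝ} (hs : s ∈ Set.Ico (0 : ℝ) 1) :
    Filter.Tendsto (fun t => K.logDeriv s t - ‖K.velocity s‖ / (K.length - K.arcLength s t))
      (𝓝[<] (s + 1)) (𝓝 0) := by
  obtain ⟨M, hM⟩ := K.exists_logDeriv_bound
  have hc := (K.continuous_arcLength_right s).continuousAt (x := s + 1)
  have hL : K.length / 2 < K.arcLength s (s + 1) := by
    rw [arcLength_add_one]; exact half_lt_self K.length_pos
  have h0 : Filter.Tendsto (fun t => ‖K.velocity s‖ * (M * (K.length - K.arcLength s t)))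
      (𝓝[<] (s + 1)) (𝓝 0) := by
    have := ((hc.const_sub K.length).const_mul M).const_mul ‖K.velocity s‖
    rw [arcLength_add_one, sub_self, mul_zero, mul_zero] at this
    exact this.mono_left nhdsWithin_le_nhds
  refine squeeze_zero_norm' ?_ h0
  filter_upwards [Ioo_mem_nhdsLT (show s < s + 1 by linarith),
    nhdsWithin_le_nhds (hc.eventually_const_lt hL)] with t ht htL
  exact (hM s hs t ht).2 htL.le

/-- The difference of the two integrands, on a period starting at `s`. -/
lemma integrand_sub_fract {s t : ℝ} (hs : s ∈ Set.Ico (0 : ℝ) 1) (ht : t ∈ Set.Ioo s (s + 1)) :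
    K.energyIntegrand (s, Int.fract t) - K.crossRatioKernel (s, Int.fract t) =
      logKernel (K.toFun s - K.toFun t) (K.velocity s) (K.velocity t) -
        ‖K.velocity s‖ * ‖K.velocity t‖ /
          min (K.arcLength s t) (K.length - K.arcLength s t) ^ 2 := by
  have key : K.toFun (Int.fract t) = K.toFun t ∧ K.velocity (Int.fract t) = K.velocity t ∧
      K.arcDist s (Int.fract t) = min (K.arcLength s t) (K.length - K.arcLength s t) := by
    rcases lt_or_ge t 1 with h1 | h1
    · have : Int.fract t = t := Int.fract_eq_self.2 ⟨hs.1.trans ht.1.le, h1⟩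
      rw [this, arcDist, abs_of_pos (K.arcLength_pos ht.1)]
      exact ⟨rfl, rfl, rfl⟩
    -- Here t - 1 < s, so the signed arc is A - L with absolute value L - A: the two arcs exchange
    -- roles in the minimum.
    · have : Int.fract t = t - 1 := by
        rw [← Int.fract_sub_one]
        exact Int.fract_eq_self.2 ⟨by linarith, by linarith [hs.2, ht.2]⟩
      have h2 := K.arcLength_pos ht.2
      rw [arcLength_complement] at h2
      rw [this, arcDist, arcLength_sub_one, abs_of_neg (by linarith), min_comm]
      refine ⟨K.toFun_sub_one t, K.velocity_sub_one t, ?_⟩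
      congr 1 <;> ring
  obtain ⟨e1, e2, e3⟩ := key
  simp only [energyIntegrand, crossRatioKernel]
  rw [e1, e2, e3]
  ring

lemma exists_antipode (s : ℝ) : ∃ t ∈ Set.Ioo s (s + 1), K.arcLength s t = K.length / 2 := by
  have hL := K.length_pos
  obtain ⟨t, ht, h⟩ := intermediate_value_Ioo (show s ≤ s + 1 by linarith)
    (K.continuous_arcLength_right s).continuousOn
    (show K.length / 2 ∈ Set.Ioo (K.arcLength s s) (K.arcLength s (s + 1)) by
      rw [arcLength_self, arcLength_add_one]; constructor <;> linarith)
  exact ⟨t, ht, h⟩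

lemma intervalIntegrable_integrand_sub {s : ℝ} (hs : s ∈ Set.Ico (0 : ℝ) 1) (a b : ℝ) :
    IntervalIntegrable (fun t => K.energyIntegrand (s, Int.fract t) -
      K.crossRatioKernel (s, Int.fract t)) MeasureTheory.volume a b := by
  obtain ⟨M, hM⟩ := K.exists_integrand_bound
  have hm : Measurable fun t : ℝ => (s, Int.fract t) := measurable_const.prodMk measurable_fract
  refine (intervalIntegrable_const (c := M + M)).mono_fun'
    ((K.measurable_energyIntegrand.comp hm).sub
      (K.measurable_crossRatioKernel.comp hm)).aestronglyMeasurable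
    (Filter.Eventually.of_forall fun t => ?_)
  have h := hM (s, Int.fract t) ⟨hs, Int.fract_nonneg t, Int.fract_lt_one t⟩
  exact (abs_sub _ _).trans (add_le_add h.1 h.2)

/-- The integral over one variable of the difference of the two integrands. -/
lemma integral_integrand_sub {s : ℝ} (hs : s ∈ Set.Ico (0 : ℝ) 1) :
    ∫ t in Set.Ico (0 : ℝ) 1, (K.energyIntegrand (s, t) - K.crossRatioKernel (s, t)) =
      4 * ‖K.velocity s‖ / K.length := by
  set g : ℝ → ℝ := fun t => K.energyIntegrand (s, Int.fract t) -
    K.crossRatioKernel (s, Int.fract t) with hg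
  have hint := K.intervalIntegrable_integrand_sub hs
  have hL := K.length_pos
  have hper : Function.Periodic g 1 := fun t => by simp only [hg, Int.fract_add_one]
  -- Starting the period at s puts the diagonal at the two end points of the interval of
  -- integration.
  have h1 : ∫ t in Set.Ico (0 : ℝ) 1, (K.energyIntegrand (s, t) - K.crossRatioKernel (s, t)) =
      ∫ t in s..s + 1, g t := by
    rw [hper.intervalIntegral_add_eq s 0, zero_add, intervalIntegral.integral_of_le zero_le_one,
      ← MeasureTheory.integral_Ico_eq_integral_Ioc]
    refine MeasureTheory.setIntegral_congr_fun measurableSet_Ico fun t ht => ?_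
    simp only [hg, Int.fract_eq_self.2 ht]
  obtain ⟨m, hm, hmA⟩ := K.exists_antipode s
  have h2 : ∫ t in s..m, g t = (K.logDeriv s m + ‖K.velocity s‖ / K.arcLength s m) - 0 := by
    refine intervalIntegral.integral_eq_sub_of_hasDerivAt_of_tendsto hm.1 (fun t ht => ?_)
      (hint s m) (K.tendsto_logDeriv_add hs) ?_
    · have ht' : t ∈ Set.Ioo s (s + 1) := ⟨ht.1, ht.2.trans hm.2⟩
      have h3 := K.arcLength_pos ht.2
      have h4 := K.arcLength_add s t m
      have h5 := K.hasDerivAt_logDeriv_add (K.toFun_ne ht'.1 ht'.2) (K.arcLength_pos ht'.1).ne'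
      rw [hg]
      simp only
      rw [K.integrand_sub_fract hs ht', min_eq_left (by linarith)]
      exact h5
    · exact (K.hasDerivAt_logDeriv_add (K.toFun_ne hm.1 hm.2)
        (K.arcLength_pos hm.1).ne').continuousAt.tendsto.mono_left nhdsWithin_le_nhds
  have h3 : ∫ t in m..s + 1, g t =
      0 - (K.logDeriv s m - ‖K.velocity s‖ / (K.length - K.arcLength s m)) := by
    refine intervalIntegral.integral_eq_sub_of_hasDerivAt_of_tendsto hm.2 (fun t ht => ?_)
      (hint m (s + 1)) ?_ (K.tendsto_logDeriv_sub hs)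
    · have ht' : t ∈ Set.Ioo s (s + 1) := ⟨hm.1.trans ht.1, ht.2⟩
      have h3 := K.arcLength_pos ht.1
      have h4 := K.arcLength_add s m t
      have h6 := K.arcLength_pos ht.2
      rw [arcLength_complement] at h6
      have h5 := K.hasDerivAt_logDeriv_sub (K.toFun_ne ht'.1 ht'.2) h6.ne'
      rw [hg]
      simp only
      rw [K.integrand_sub_fract hs ht', min_eq_right (by linarith)]
      exact h5
    · exact (K.hasDerivAt_logDeriv_sub (K.toFun_ne hm.1 hm.2)
        (by rw [hmA]; linarith)).continuousAt.tendsto.mono_left nhdsWithin_le_nhds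
  rw [h1, ← intervalIntegral.integral_add_adjacent_intervals (hint s m) (hint m (s + 1))]
  change (∫ t in s..m, g t) + ∫ t in m..s + 1, g t = _
  -- The `logDeriv` values at m cancel, leaving twice ‖K'(s)‖ / (L / 2).
  rw [h2, h3, hmA]
  field_simp
  ring

lemma integral_square_integrand_sub :
    ∫ p in square, (K.energyIntegrand p - K.crossRatioKernel p) = 4 := by
  have hi : MeasureTheory.IntegrableOn
      (fun p => K.energyIntegrand p - K.crossRatioKernel p) square :=
    K.integrableOn_energyIntegrand.sub K.integrableOn_crossRatioKernel
  have hL := K.length_pos.ne'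
  rw [square, MeasureTheory.Measure.volume_eq_prod] at hi ⊢
  rw [MeasureTheory.setIntegral_prod _ hi,
    MeasureTheory.setIntegral_congr_fun measurableSet_Ico fun s hs => K.integral_integrand_sub hs,
    MeasureTheory.integral_Ico_eq_integral_Ioc, ← intervalIntegral.integral_of_le zero_le_one,
    intervalIntegral.integral_div, intervalIntegral.integral_const_mul]
  change 4 * K.length / K.length = 4
  field_simp

end Knot

/-! ### Conclusion -/

/-- Integrability of the integrand defined by choice is obtained by passing to the explicit
measurable kernel. -/
lemma crossRatioIntegrand_eqOn (K : Knot) :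
    Set.EqOn (crossRatioIntegrand K) K.crossRatioKernel Knot.offDiagSquare :=
  fun _ hp => crossRatioIntegrand_eq (K.toFun_ne_of_mem_offDiagSquare hp)

lemma Knot.measurableSet_offDiagSquare : MeasurableSet Knot.offDiagSquare :=
  Knot.measurableSet_square.inter (measurableSet_eq_fun measurable_fst measurable_snd).compl

end

theorem mainTheorem1 (K : Knot) :
    (∀ p ∈ Knot.offDiagSquare, ∃! ω : ℂ, IsInfinitesimalCrossRatio K p.1 p.2 ω) ∧
    MeasureTheory.IntegrableOn K.energyIntegrand Knot.square ∧
    MeasureTheory.IntegrableOn (crossRatioIntegrand K) Knot.offDiagSquare ∧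
    K.energy = ∫ p in Knot.offDiagSquare, crossRatioIntegrand K p := by
  have hsub : Knot.offDiagSquare ⊆ Knot.square := fun p hp => hp.1
  refine ⟨fun p hp => existsUnique_isInfinitesimalCrossRatio (K.toFun_ne_of_mem_offDiagSquare hp),
    K.integrableOn_energyIntegrand, ?_, ?_⟩
  · exact (K.integrableOn_crossRatioKernel.mono_set hsub).congr_fun
      (crossRatioIntegrand_eqOn K).symm Knot.measurableSet_offDiagSquare
  · rw [MeasureTheory.setIntegral_congr_fun Knot.measurableSet_offDiagSquare
      (crossRatioIntegrand_eqOn K), ← MeasureTheory.setIntegral_eq_of_subset_of_forall_sdiff_eq_zero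
      Knot.measurableSet_square hsub]
    · have h := K.integral_square_integrand_sub
      rw [MeasureTheory.integral_sub K.integrableOn_energyIntegrand
        K.integrableOn_crossRatioKernel] at h
      rw [Knot.energy]
      linarith
    · rintro ⟨s, t⟩ ⟨hp, hn⟩
      have hst : s = t := by
        by_contra hne
        exact hn ⟨hp, hne⟩
      subst hst
      exact K.crossRatioKernel_diag s
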